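/- Let $d\ge 1$ and let $\phi:\mathbb R\to\mathbb R$ be bounded and compactly supported, with $\int\phi=1$, and an orthonormal scaling function: there are closed subspaces $\cdots\subset V_1\subset V_0\subset V_{-1}\subset\cdots$ of $L^2(\mathbb R)$ with $\overline{\bigcup_j V_j}=L^2(\mathbb R)$, $\bigcap_j V_j=\{0\}$ and $f\in V_j\Leftrightarrow f(2\,\cdot)\in V_{j-1}$ for all $j\in\mathbb Z$, such that $(\phi(\cdot-k))_{k\in\mathbb Z}$ is an orthonormal basis of $V_0$. For $j\in\mathbb N$ and $\mathbf k\in\mathbb Z^d$ put $\Phi_{-j,\mathbf k}(\mathbf x)=\prod_{i=1}^d 2^{j/2}\phi(2^jx_i-k_i)$, let $\mathcal I(j)=\{\mathbf k\in\mathbb Z^d:\operatorname{supp}\Phi_{-j,\mathbf k}\subset[0,1]^d\}$, $n=|\mathcal I(j)|$, and $$K(\mathbf x,\mathbf y)=\sum_{\mathbf k\in\mathcal I(j)}\Phi_{-j,\mathbf k}(\mathbf x)\Phi_{-j,\mathbf k}(\mathbf y),\qquad \mathbf x,\mathbf y\in\mathbb R^d.$$ Let $\mathcal S$ be a determinantal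 point process on $\mathbb R^d$ with kernel $K$ and reference measure the Lebesgue measure: a random locally finite subset of $\mathbb R^d$ such that, for all $k$, $\det[K(\mathbf x_a,\mathbf x_b)]_{1\le a,b\le k}$ is the density with respect to Lebesgue measure on $(\mathbb R^d)^k$ of the $k$-th factorial moment measure (the expected sum over $k$-tuples of pairwise distinct points of $\mathcal S$). Write $\Lambda_{\mathcal S}(f)=\sum_{Y\in\mathcal S}f(Y)$. Then there is a constant $C>0$, depending only on $\phi$ and $d$, such that for every $s\in(0,1]$, every $j\in\mathbb N$ with $n\ge1$, every such $\mathcal S$, and every bounded $f:\mathbb R^d\to\mathbb R$ that vanishes outside $(0,1)^d$ and belongs either to the Hölder space $C^{0,s}(\mathbb R^d)$ or to the Sobolev space $H^s((0,1)^d)$, the random variable $\Lambda_{\mathcal S}(f)$ is square-integrable and $$\operatorname{Var}[\Lambda_{\mathcal S}(f)]\le C\,|f|_s^2\,n^{1-2s/d}.$$ Here $|f|_s$ is, in the Hölder case, the seminorm $\sup_{\mathbf x\ne\mathbf y}|f(\mathbf x)-f(\mathbf y)|/\|\mathbf x-\mathbf y\|^s$; in the Sobolev case, for $s<1$, the Gagliardo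 seminorm $\big(\iint_{(0,1)^d\times(0,1)^d}\frac{(f(\mathbf x)-f(\mathbf y))^2}{\|\mathbf x-\mathbf y\|^{d+2s}}\,d\mathbf x\,d\mathbf y\big)^{1/2}$, and for $s=1$ the norm $\|\nabla f\|_{L^2((0,1)^d)}$ of the weak gradient. -/

import Mathlib

open MeasureTheory ProbabilityTheory
open scoped ENNReal

noncomputable section

namespace WaveletDPP

/-! ### Point processes, determinantal point processes, linear statistics -/

section PointProcess

variable {Ω E : Type*} [MeasurableSpace Ω] [MetricSpace E] [MeasurableSpace E]

/-- A (simple) point process: a random locally finite subset `S ω` of `E`, measurable in the sense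
that the number of points in every measurable set is a random variable. -/
structure IsPointProcess (S : Ω → Set E) : Prop where
  locallyFinite : ∀ ω, ∀ B : Set E, Bornology.IsBounded B → (S ω ∩ B).Finite
  measurable_count : ∀ B : Set E, MeasurableSet B → Measurable fun ω => (S ω ∩ B).encard

/-- `S` is a determinantal point process with (real) kernel `K` and reference measure `μ` : for
every `k`, the sum of `F` over the `k`-tuples of pairwise distinct points of `S` has expectation
`∫ F(x₁, …, x_k) det [K(x_i, x_j)] dμ(x₁) … dμ(x_k)`, for all measurable `F ≥ 0`. The determinants
are required to be nonnegative almost everywhere, so that `ENNReal.ofReal` does not truncate. -/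
structure IsDPP (P : Measure Ω) (S : Ω → Set E) (K : E → E → ℝ) (μ : Measure E) : Prop where
  isPointProcess : IsPointProcess S
  det_nonneg : ∀ k : ℕ, ∀ᵐ x ∂(Measure.pi fun _ : Fin k => μ),
    0 ≤ (Matrix.of fun i j => K (x i) (x j)).det
  correlation : ∀ (k : ℕ) (F : (Fin k → E) → ℝ≥0∞), Measurable F →
    ∫⁻ ω, ∑' x : {x : Fin k → E // Function.Injective x ∧ ∀ i, x i ∈ S ω}, F x ∂P =
      ∫⁻ x, F x * ENNReal.ofReal (Matrix.of fun i j => K (x i) (x j)).det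
        ∂(Measure.pi fun _ : Fin k => μ)

/-- The linear statistic `Λ_S(f) = ∑_{Y ∈ S} f(Y)`. -/
def linStat (S : Ω → Set E) (f : E → ℝ) (ω : Ω) : ℝ := ∑' y : S ω, f y

end PointProcess

/-! ### Multiresolution approximations and scaling functions -/

/-- The real Hilbert space `L²(ℝ)`. -/
abbrev L2R : Type := Lp ℝ 2 (volume : Measure ℝ)

/-- A multiresolution approximation `⋯ ⊂ V₁ ⊂ V₀ ⊂ V₋₁ ⊂ ⋯` of `L²(ℝ)`. In `scaling`, `g` is the
class of `x ↦ f (2 x)`. -/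
structure IsMultiresolution (V : ℤ → Submodule ℝ L2R) : Prop where
  isClosed : ∀ j, IsClosed (V j : Set L2R)
  nested : ∀ j, V (j + 1) ≤ V j
  dense : Dense (⋃ j, (V j : Set L2R))
  inter : ⨅ j, V j = ⊥
  scaling : ∀ (j : ℤ) (f g : L2R), (g =ᵐ[volume] fun x => f (2 * x)) → (f ∈ V j ↔ g ∈ V (j - 1))

/-- `φ` is an orthonormal scaling function: its integer translates (with classes `e k` in `L²(ℝ)`)
form an orthonormal basis of the space `V₀` of a multiresolution approximation. -/
def IsOrthonormalScaling (φ : ℝ → ℝ) : Prop :=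
  ∃ V : ℤ → Submodule ℝ L2R, IsMultiresolution V ∧
    ∃ e : ℤ → L2R, (∀ k, e k =ᵐ[volume] fun x => φ (x - k)) ∧
      Orthonormal ℝ e ∧ (Submodule.span ℝ (Set.range e)).topologicalClosure = V 0

/-- A bounded, compactly supported, orthonormal scaling function with `∫ φ = 1`. -/
structure IsAdmissibleScaling (φ : ℝ → ℝ) : Prop where
  bounded : ∃ M : ℝ, ∀ x, |φ x| ≤ M
  compactSupport : HasCompactSupport φ
  orthonormalScaling : IsOrthonormalScaling φ
  integral_eq_one : ∫ x, φ x = 1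

/-! ### The wavelet kernel -/

/-- `φ_{j,k}(x) = 2^{-j/2} φ(2^{-j} x - k)`. -/
def dil (φ : ℝ → ℝ) (j k : ℤ) (x : ℝ) : ℝ :=
  (2 : ℝ) ^ (-(j : ℝ) / 2) * φ ((2 : ℝ) ^ (-j) * x - k)

/-- `Φ_{j,k}(x) = ∏ᵢ φ_{j,kᵢ}(xᵢ)`. -/
def tensorDil {d : ℕ} (φ : ℝ → ℝ) (j : ℤ) (k : Fin d → ℤ) (x : EuclideanSpace ℝ (Fin d)) : ℝ :=
  ∏ i, dil φ j (k i) (x i)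

/-- The closed unit cube `[0,1]^d`. -/
def closedCube (d : ℕ) : Set (EuclideanSpace ℝ (Fin d)) := {x | ∀ i, x i ∈ Set.Icc (0 : ℝ) 1}

/-- The open unit cube `(0,1)^d`. -/
def openCube (d : ℕ) : Set (EuclideanSpace ℝ (Fin d)) := {x | ∀ i, x i ∈ Set.Ioo (0 : ℝ) 1}

/-- `𝓘(j)`: the multi-indices `k` such that `supp Φ_{-j,k} ⊆ [0,1]^d`. -/
def indexSet (d : ℕ) (φ : ℝ → ℝ) (j : ℕ) : Set (Fin d → ℤ) :=
  {k | tsupport (tensorDil φ (-(j : ℤ)) k) ⊆ closedCube d}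

/-- `n = |𝓘(j)|`. -/
def numPoints (d : ℕ) (φ : ℝ → ℝ) (j : ℕ) : ℕ := (indexSet d φ j).ncard

/-- `K(x,y) = ∑_{k ∈ 𝓘(j)} Φ_{-j,k}(x) Φ_{-j,k}(y)`. -/
def waveletKernel (d : ℕ) (φ : ℝ → ℝ) (j : ℕ) (x y : EuclideanSpace ℝ (Fin d)) : ℝ :=
  ∑ᶠ k ∈ indexSet d φ j, tensorDil φ (-(j : ℤ)) k x * tensorDil φ (-(j : ℤ)) k y

/-! ### Test functions -/

section TestFunctions

variable {d : ℕ}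

/-- Bounded functions vanishing outside `(0,1)^d`. -/
def IsTestFunction (f : EuclideanSpace ℝ (Fin d) → ℝ) : Prop :=
  (∀ x, x ∉ openCube d → f x = 0) ∧ ∃ M : ℝ, ∀ x, |f x| ≤ M

/-- The square of the Gagliardo seminorm,
`∬_{U × U} (f(x) - f(y))² / ‖x - y‖^{d + 2s} dx dy`, with values in `[0, ∞]`. -/
def gagliardoSq (s : ℝ) (U : Set (EuclideanSpace ℝ (Fin d)))
    (f : EuclideanSpace ℝ (Fin d) → ℝ) : ℝ≥0∞ :=
  ∫⁻ p in U ×ˢ U, ENNReal.ofReal ((f p.1 - f p.2) ^ 2 / ‖p.1 - p.2‖ ^ ((d : ℝ) + 2 * s))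

/-- `f ∈ H^s(U)`, for `0 < s < 1`. -/
def MemFracSobolev (s : ℝ) (U : Set (EuclideanSpace ℝ (Fin d)))
    (f : EuclideanSpace ℝ (Fin d) → ℝ) : Prop :=
  MemLp f 2 (volume.restrict U) ∧ gagliardoSq s U f < ∞

/-- `f ∈ H¹(U)` with weak gradient `g`: `f` and `g` are square-integrable on `U`, and
`∫_U f ∂ᵢψ = - ∫_U gᵢ ψ` for all `i` and all smooth `ψ` with compact support in `U`. -/
structure HasSobolevGradient (U : Set (EuclideanSpace ℝ (Fin d)))
    (f : EuclideanSpace ℝ (Fin d) → ℝ)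
    (g : EuclideanSpace ℝ (Fin d) → EuclideanSpace ℝ (Fin d)) : Prop where
  memLp : MemLp f 2 (volume.restrict U)
  memLp_grad : MemLp g 2 (volume.restrict U)
  weak_deriv : ∀ (i : Fin d) (ψ : EuclideanSpace ℝ (Fin d) → ℝ),
    ContDiff ℝ (⊤ : ℕ∞) ψ → HasCompactSupport ψ → tsupport ψ ⊆ U →
      ∫ x in U, f x * fderiv ℝ ψ x (EuclideanSpace.single i 1) = - ∫ x in U, g x i * ψ x

/-- `f` belongs to `C^{0,s}(ℝ^d)` or to `H^s((0,1)^d)` and `A` is the corresponding seminorm `|f|_s`: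
the Hölder seminorm, or the Gagliardo seminorm (`s < 1`), or `‖∇f‖_{L²((0,1)^d)}` (`s = 1`). -/
def IsSeminormOf (s : ℝ) (f : EuclideanSpace ℝ (Fin d) → ℝ) (A : ℝ) : Prop :=
  (MemHolder s.toNNReal f ∧ A = nnHolderNorm s.toNNReal f) ∨
  (s < 1 ∧ MemFracSobolev s (openCube d) f ∧ A = √(gagliardoSq s (openCube d) f).toReal) ∨
  (s = 1 ∧ ∃ g, HasSobolevGradient (openCube d) f g ∧
    A = √(∫ x in openCube d, ‖g x‖ ^ 2))

end TestFunctions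

end WaveletDPP

end

open WaveletDPP

noncomputable section

namespace WaveletDPP

/-! ### Variance of linear statistics of projection determinantal processes. -/

section ProjectionDPP

/-! `waveletKernel` is the kernel of an orthogonal projection, because the functions `tensorDil φ
(-j) k` are orthonormal. For such a process the variance is a Dirichlet form, Var Λ(f) = ½ ∬ (f(x) -
f(y))² K(x,y)² dx dy (`IsDPP.variance_linStat`), so only the size and the support of K matter.

With N = 2^(jd), compact support of φ gives: K lives on pairs of points of the cube at distance
O(2^(-j)), |K| = O(N), and ∬ K² = n, where n is comparable to N. In the Hölder case (f(x) - f(y))² ≤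
A² O(2^(-2js)) on the support of K, and integrating against K² gives A² O(2^(-2js)) N. In the
Sobolev cases K² is replaced by its supremum, and it remains to bound ∬ (f(x) - f(y))² over pairs at
distance at most ρ by O(ρ^(d+2s)) A². For s < 1 this is read off the Gagliardo integrand. For s = 1
it follows from ‖f(· + h) - f‖ ≤ ‖h‖ ‖∇f‖ in L²
(`HasSobolevGradient.lintegral_translate_sub_sq_le`), proved by mollification inside the convex
cube.

All cases give A² N^(1-2s/d) up to a constant, and N is finally exchanged for n. -/

theorem IsPointProcess.measurable_tsum {Ω E : Type*} [MeasurableSpace Ω] [MetricSpace E]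
    [MeasurableSpace E] {S : Ω → Set E} (hS : IsPointProcess S) {h : E → ℝ≥0∞}
    (hh : Measurable h) : Measurable fun ω => ∑' y : S ω, h y := by
  refine Measurable.ennreal_induction
    (motive := fun h => Measurable fun ω => ∑' y : S ω, h y) ?_ ?_ ?_ hh
  · intro c s hs
    have key : ∀ ω, ∑' y : S ω, s.indicator (fun _ => c) (y : E)
        = (((S ω ∩ s).encard : ℕ∞) : ℝ≥0∞) * c := by
      intro ω
      rw [tsum_subtype (S ω) (s.indicator fun _ => c), Set.indicator_indicator,
        ← tsum_subtype (S ω ∩ s) fun _ => c, ENNReal.tsum_const]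
      rfl
    simp_rw [key]
    exact (Measurable.of_discrete.comp (hS.measurable_count s hs)).mul_const c
  · intro f g _ hf hg ihf ihg
    simp only [Pi.add_apply, ENNReal.tsum_add]
    exact ihf.add ihg
  · intro f hf hmono ih
    have key : ∀ ω, ∑' y : S ω, (⨆ n, f n (y : E)) = ⨆ n, ∑' y : S ω, f n (y : E) := by
      intro ω
      simp_rw [ENNReal.tsum_eq_iSup_sum]
      rw [iSup_comm]
      refine iSup_congr fun t => ?_
      rw [ENNReal.finsetSum_iSup_of_monotone]
      exact fun a m n hmn => hmono hmn _
    simp_rw [key]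
    exact Measurable.iSup ih

/-- Separates the part of the second moment governed by the two-point correlation from the part
governed by the one-point correlation. -/
theorem tsum_sq_eq_add_offDiag {E : Type*} (s : Set E) (h : E → ℝ≥0∞) :
    (∑' y : s, h y) ^ 2 =
      ∑' x : {x : Fin 2 → E // Function.Injective x ∧ ∀ i, x i ∈ s}, h (x.1 0) * h (x.1 1)
        + ∑' y : s, h y ^ 2 := by
  classical
  have e1 : (∑' y : s, h y) ^ 2 = ∑' p : s × s, h p.1 * h p.2 := by
    rw [ENNReal.tsum_prod (f := fun (a b : s) => h a * h b), sq, ← ENNReal.tsum_mul_right]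
    exact tsum_congr fun a => ENNReal.tsum_mul_left.symm
  have e2 : ∑' p : s × s, h p.1 * h p.2 =
      ∑' p : s × s, ({p | p.1 ≠ p.2} : Set (s × s)).indicator
          (fun p => h p.1 * h p.2) p
        + ∑' p : s × s, (if p.2 = p.1 then h p.1 ^ 2 else 0) := by
    rw [← ENNReal.tsum_add]
    refine tsum_congr fun p => ?_
    by_cases hp : p.1 = p.2
    · simp [Set.indicator, hp, sq]
    · simp [Set.indicator, hp, Ne.symm hp]
  have e3 : ∑' p : s × s, (if p.2 = p.1 then h p.1 ^ 2 else 0) = ∑' y : s, h y ^ 2 := by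
    rw [ENNReal.tsum_prod (f := fun (a b : s) => if b = a then h a ^ 2 else 0)]
    exact tsum_congr fun a => by simp
  let e : {x : Fin 2 → E // Function.Injective x ∧ ∀ i, x i ∈ s} ≃
      ({p | p.1 ≠ p.2} : Set (s × s)) :=
    { toFun := fun x => ⟨(⟨x.1 0, x.2.2 0⟩, ⟨x.1 1, x.2.2 1⟩), fun hx => by
        have := x.2.1 (Subtype.ext_iff.1 hx)
        simp at this⟩
      invFun := fun p => ⟨![p.1.1, p.1.2], by
        refine ⟨fun i j hij => ?_, fun i => ?_⟩
        · have hp : (p.1.1 : E) ≠ p.1.2 := fun hh => p.2 (Subtype.ext hh)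
          fin_cases i <;> fin_cases j <;> simp_all [eq_comm]
        · fin_cases i <;> simp⟩
      left_inv := fun x => by
        ext i
        fin_cases i <;> simp
      right_inv := fun p => by simp }
  rw [e1, e2, e3, ← tsum_subtype, ← e.tsum_eq]
  rfl

theorem linStat_eq_toReal {Ω E : Type*} {S : Ω → Set E} {h : E → ℝ} (h0 : ∀ x, 0 ≤ h x) (ω : Ω) :
    linStat S h ω = (∑' y : S ω, ENNReal.ofReal (h y)).toReal := by
  rw [ENNReal.tsum_toReal_eq fun _ => ENNReal.ofReal_ne_top]
  simp [linStat, ENNReal.toReal_ofReal, h0]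

section ProjectionKernel

variable {E : Type*} [MeasurableSpace E] {K : E → E → ℝ} {μ : Measure E}

/-- `K` is the kernel of a trace-class orthogonal projection of `L²(μ)`. -/
structure IsProjectionKernel {E : Type*} [MeasurableSpace E] (K : E → E → ℝ) (μ : Measure E) : Prop where
  symm : ∀ x y, K x y = K y x
  integrable_diag : Integrable (fun x => K x x) μ
  integrable_sq : Integrable (fun p : E × E => K p.1 p.2 ^ 2) (μ.prod μ)
  nonneg_diag : ∀ x, 0 ≤ K x x
  integral_sq : ∀ x, ∫ y, K x y ^ 2 ∂μ = K x x

/-- Expanding K(x,y)² into a double sum and integrating in y, orthonormality leaves only the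
diagonal terms, which add up to K(x,x). -/
theorem IsProjectionKernel.of_orthonormal {ι : Type*} [DecidableEq ι] (I : Finset ι)
    (u : ι → E → ℝ) (hu : ∀ k ∈ I, MemLp (u k) 2 μ)
    (horth : ∀ k ∈ I, ∀ l ∈ I, ∫ x, u k x * u l x ∂μ = if k = l then 1 else 0) :
    IsProjectionKernel (fun x y => ∑ k ∈ I, u k x * u k y) μ := by
  have hint : ∀ k ∈ I, ∀ l ∈ I, Integrable (fun x => u k x * u l x) μ :=
    fun k hk l hl => (hu k hk).integrable_mul (hu l hl)
  have hsq : ∀ x y, (∑ k ∈ I, u k x * u k y) ^ 2 =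
      ∑ k ∈ I, ∑ l ∈ I, (u k x * u l x) * (u k y * u l y) := by
    intro x y
    rw [sq, Finset.sum_mul_sum]
    exact Finset.sum_congr rfl fun k _ => Finset.sum_congr rfl fun l _ => by ring
  refine ⟨fun x y => Finset.sum_congr rfl fun k _ => mul_comm _ _,
    integrable_finsetSum _ fun k hk => hint k hk k hk, ?_,
    fun x => Finset.sum_nonneg fun k _ => mul_self_nonneg _, fun x => ?_⟩
  · simp_rw [hsq]
    exact integrable_finsetSum _ fun k hk => integrable_finsetSum _ fun l hl =>
      (hint k hk l hl).mul_prod (hint k hk l hl)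
  · simp_rw [hsq]
    rw [integral_finsetSum _ fun k hk => integrable_finsetSum _ fun l hl =>
      (hint k hk l hl).const_mul _]
    refine Finset.sum_congr rfl fun k hk => ?_
    rw [integral_finsetSum _ fun l hl => (hint k hk l hl).const_mul _]
    calc ∑ l ∈ I, ∫ y, u k x * u l x * (u k y * u l y) ∂μ
        = ∑ l ∈ I, if k = l then u k x * u l x else 0 := by
          refine Finset.sum_congr rfl fun l hl => ?_
          rw [integral_const_mul, horth k hk l hl]
          simp
      _ = u k x * u k x := by simp [hk]

theorem integrable_bdd_mul {F G : E → ℝ} {μ : Measure E} (hG : Integrable G μ) (hF : Measurable F)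
    {M : ℝ} (hM : ∀ x, |F x| ≤ M) : Integrable (fun x => F x * G x) μ :=
  hG.bdd_mul (c := M) hF.aestronglyMeasurable (Filter.Eventually.of_forall hM)

variable [SigmaFinite μ]

theorem IsProjectionKernel.integral_sq_fst (hK : IsProjectionKernel K μ) {h : E → ℝ}
    (hh : Measurable h) {M : ℝ} (hM : ∀ x, |h x| ≤ M) :
    ∫ p, h p.1 ^ 2 * K p.1 p.2 ^ 2 ∂(μ.prod μ) = ∫ x, h x ^ 2 * K x x ∂μ := by
  have hM2 : ∀ x, |h x ^ 2| ≤ M ^ 2 := fun x => by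
    rw [abs_pow]
    exact pow_le_pow_left₀ (abs_nonneg _) (hM x) 2
  rw [integral_prod (fun p : E × E => h p.1 ^ 2 * K p.1 p.2 ^ 2)]
  · simp_rw [integral_const_mul, hK.integral_sq]
  · exact integrable_bdd_mul hK.integrable_sq ((hh.pow_const 2).comp measurable_fst)
      (M := M ^ 2) fun p => hM2 p.1

/-- When the square is expanded, the reproducing property and the symmetry of K turn both pure
square terms into the same diagonal integral. -/
theorem IsProjectionKernel.integral_sub_sq (hK : IsProjectionKernel K μ) {h : E → ℝ}
    (hh : Measurable h) {M : ℝ} (hM : ∀ x, |h x| ≤ M) :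
    ∫ p, (h p.1 - h p.2) ^ 2 * K p.1 p.2 ^ 2 ∂(μ.prod μ) =
      2 * (∫ x, h x ^ 2 * K x x ∂μ - ∫ p, h p.1 * h p.2 * K p.1 p.2 ^ 2 ∂(μ.prod μ)) := by
  have hM2 : ∀ x y, |h x * h y| ≤ M * M := fun x y => by
    rw [abs_mul]
    exact mul_le_mul (hM x) (hM y) (abs_nonneg _) ((abs_nonneg _).trans (hM x))
  have i1 : Integrable (fun p : E × E => h p.1 ^ 2 * K p.1 p.2 ^ 2) (μ.prod μ) :=
    integrable_bdd_mul hK.integrable_sq ((hh.pow_const 2).comp measurable_fst)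
      (M := M * M) fun p => by simpa [sq] using hM2 p.1 p.1
  have i2 : Integrable (fun p : E × E => h p.2 ^ 2 * K p.1 p.2 ^ 2) (μ.prod μ) :=
    integrable_bdd_mul hK.integrable_sq ((hh.pow_const 2).comp measurable_snd)
      (M := M * M) fun p => by simpa [sq] using hM2 p.2 p.2
  have i3 : Integrable (fun p : E × E => h p.1 * h p.2 * K p.1 p.2 ^ 2) (μ.prod μ) :=
    integrable_bdd_mul hK.integrable_sq ((hh.comp measurable_fst).mul (hh.comp measurable_snd))
      (M := M * M) fun p => hM2 p.1 p.2
  have e2 : ∫ p, h p.2 ^ 2 * K p.1 p.2 ^ 2 ∂(μ.prod μ) = ∫ x, h x ^ 2 * K x x ∂μ := by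
    rw [← hK.integral_sq_fst hh hM, ← integral_prod_swap]
    congr 1 with p
    rw [Prod.fst_swap, Prod.snd_swap, hK.symm]
  have : ∀ p : E × E, (h p.1 - h p.2) ^ 2 * K p.1 p.2 ^ 2 =
      h p.1 ^ 2 * K p.1 p.2 ^ 2 + h p.2 ^ 2 * K p.1 p.2 ^ 2
        - 2 * (h p.1 * h p.2 * K p.1 p.2 ^ 2) := fun p => by ring
  simp_rw [this]
  rw [integral_sub (f := fun p : E × E => _ + _) (i1.add i2) (i3.const_mul 2), integral_add i1 i2, integral_const_mul, e2,
    hK.integral_sq_fst hh hM]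
  ring

end ProjectionKernel

variable {Ω E : Type*} [MeasurableSpace Ω] [MetricSpace E] [MeasurableSpace E]
  {P : Measure Ω} {S : Ω → Set E} {K : E → E → ℝ} {μ : Measure E}

theorem IsDPP.lintegral_tsum (hS : IsDPP P S K μ) {h : E → ℝ≥0∞} (hh : Measurable h) :
    ∫⁻ ω, ∑' y : S ω, h y ∂P = ∫⁻ x, h x * ENNReal.ofReal (K x x) ∂μ := by
  have h1 := hS.correlation 1 (fun x => h (x 0)) (by fun_prop)
  have e : ∀ ω, ∑' x : {x : Fin 1 → E // Function.Injective x ∧ ∀ i, x i ∈ S ω}, h (x.1 0)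
      = ∑' y : S ω, h y := by
    intro ω
    let e : {x : Fin 1 → E // Function.Injective x ∧ ∀ i, x i ∈ S ω} ≃ S ω :=
      { toFun := fun x => ⟨x.1 0, x.2.2 0⟩
        invFun := fun y => ⟨fun _ => y, Function.injective_of_subsingleton _, fun _ => y.2⟩
        left_inv := fun x => by
          ext i
          simp [Subsingleton.elim i 0]
        right_inv := fun y => rfl }
    exact e.tsum_eq (fun y : S ω => h y)
  simp_rw [e] at h1
  rw [h1, ← (measurePreserving_funUnique μ (Fin 1)).lintegral_comp_emb
    (MeasurableEquiv.funUnique (Fin 1) E).measurableEmbedding]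
  simp [MeasurableEquiv.funUnique]
  rfl

theorem IsDPP.lintegral_ofReal (hS : IsDPP P S K μ) (hK : IsProjectionKernel K μ)
    {h : E → ℝ} (hh : Measurable h) (h0 : ∀ x, 0 ≤ h x) {M : ℝ} (hM : ∀ x, h x ≤ M) :
    ∫⁻ ω, ∑' y : S ω, ENNReal.ofReal (h y) ∂P = ENNReal.ofReal (∫ x, h x * K x x ∂μ) := by
  rw [hS.lintegral_tsum hh.ennreal_ofReal, ofReal_integral_eq_lintegral_ofReal]
  · exact lintegral_congr fun x => (ENNReal.ofReal_mul (h0 x)).symm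
  · exact integrable_bdd_mul hK.integrable_diag hh fun x => (abs_of_nonneg (h0 x)).trans_le (hM x)
  · exact Filter.Eventually.of_forall fun x => mul_nonneg (h0 x) (hK.nonneg_diag x)

/-- The expected number of points is ∫ K(x,x), which is finite. -/
theorem IsDPP.ae_finite (hS : IsDPP P S K μ) (hK : IsProjectionKernel K μ) :
    ∀ᵐ ω ∂P, (S ω).Finite := by
  have l1 := hS.lintegral_ofReal hK (h := fun _ => 1) measurable_const (fun _ => zero_le_one)
    (M := 1) fun _ => le_rfl
  have hm := hS.isPointProcess.measurable_tsum (h := fun _ => ENNReal.ofReal 1) measurable_const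
  filter_upwards [ae_lt_top hm (l1.trans_ne ENNReal.ofReal_ne_top)] with ω hω
  by_contra hinf
  have : Infinite (S ω) := Set.infinite_coe_iff.2 hinf
  rw [ENNReal.tsum_const_eq_top_of_ne_zero (by simp)] at hω
  exact lt_irrefl _ hω

/-- Almost surely no point falls in a given null set, as the expected number there is zero. This
allows test functions that are only a.e. measurable. -/
theorem IsDPP.ae_linStat_congr (hS : IsDPP P S K μ) {f g : E → ℝ} (hfg : f =ᵐ[μ] g) :
    linStat S f =ᵐ[P] linStat S g := by
  obtain ⟨N, hN, hNm, hN0⟩ := exists_measurable_superset_of_null hfg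
  have hm : Measurable (N.indicator fun _ => (1 : ℝ≥0∞)) := measurable_const.indicator hNm
  have l1 := hS.lintegral_tsum hm
  have : ∫⁻ x, N.indicator (fun _ => (1 : ℝ≥0∞)) x * ENNReal.ofReal (K x x) ∂μ = 0 := by
    rw [← lintegral_zero (μ := μ)]
    refine lintegral_congr_ae ?_
    filter_upwards [measure_eq_zero_iff_ae_notMem.1 hN0] with x hx
    simp [hx]
  rw [this, lintegral_eq_zero_iff (hS.isPointProcess.measurable_tsum hm)] at l1
  filter_upwards [l1] with ω hω
  refine tsum_congr fun y => ?_
  have hy := ENNReal.tsum_eq_zero.1 hω y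
  by_contra hne
  have : (y : E) ∈ N := hN hne
  simp [this] at hy

variable [SigmaFinite μ]

theorem IsDPP.lintegral_tsum_sq (hS : IsDPP P S K μ) {h : E → ℝ≥0∞} (hh : Measurable h) :
    ∫⁻ ω, (∑' y : S ω, h y) ^ 2 ∂P =
      ∫⁻ p, h p.1 * h p.2 * ENNReal.ofReal (K p.1 p.1 * K p.2 p.2 - K p.1 p.2 * K p.2 p.1)
          ∂(μ.prod μ) +
        ∫⁻ x, h x ^ 2 * ENNReal.ofReal (K x x) ∂μ := by
  have h2 := hS.correlation 2 (fun x => h (x 0) * h (x 1)) (by fun_prop)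
  simp_rw [tsum_sq_eq_add_offDiag]
  rw [lintegral_add_right _ (hS.isPointProcess.measurable_tsum (hh.pow_const 2)), h2,
    hS.lintegral_tsum (hh.pow_const 2), ← (measurePreserving_finTwoArrow μ).lintegral_comp_emb
    MeasurableEquiv.finTwoArrow.measurableEmbedding]
  simp [Matrix.det_fin_two, MeasurableEquiv.finTwoArrow]

theorem IsDPP.ae_nonneg_det_two (hS : IsDPP P S K μ) :
    ∀ᵐ p ∂(μ.prod μ), 0 ≤ K p.1 p.1 * K p.2 p.2 - K p.1 p.2 * K p.2 p.1 := by
  have h2 := (measurePreserving_finTwoArrow μ).symm.quasiMeasurePreserving.ae (hS.det_nonneg 2)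
  filter_upwards [h2] with p hp
  simpa [Matrix.det_fin_two, MeasurableEquiv.finTwoArrow] using hp

/-- Pairs of distinct points contribute (∫ hK)² - ∬ h h K² and the diagonal contributes ∫ h²K; the
last two terms combine into half the Dirichlet form by `IsProjectionKernel.integral_sub_sq`. -/
theorem IsDPP.lintegral_sq_ofReal (hS : IsDPP P S K μ) (hK : IsProjectionKernel K μ)
    {h : E → ℝ} (hh : Measurable h) (h0 : ∀ x, 0 ≤ h x) {M : ℝ} (hM : ∀ x, h x ≤ M) :
    ∫⁻ ω, (∑' y : S ω, ENNReal.ofReal (h y)) ^ 2 ∂P =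
      ENNReal.ofReal ((∫ x, h x * K x x ∂μ) ^ 2 +
        2⁻¹ * ∫ p, (h p.1 - h p.2) ^ 2 * K p.1 p.2 ^ 2 ∂(μ.prod μ)) := by
  have hMa : ∀ x, |h x| ≤ M := fun x => (abs_of_nonneg (h0 x)).trans_le (hM x)
  have hM2 : ∀ x y, |h x * h y| ≤ M * M := fun x y => by
    rw [abs_mul]
    exact mul_le_mul (hMa x) (hMa y) (abs_nonneg _) ((abs_nonneg _).trans (hMa x))
  have i0 : Integrable (fun x => h x * K x x) μ := integrable_bdd_mul hK.integrable_diag hh hMa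
  have i1 : Integrable (fun p : E × E => h p.1 * K p.1 p.1 * (h p.2 * K p.2 p.2)) (μ.prod μ) :=
    i0.mul_prod i0
  have i2 : Integrable (fun p : E × E => h p.1 * h p.2 * K p.1 p.2 ^ 2) (μ.prod μ) :=
    integrable_bdd_mul hK.integrable_sq ((hh.comp measurable_fst).mul (hh.comp measurable_snd))
      (M := M * M) fun p => hM2 p.1 p.2
  have i3 : Integrable (fun x => h x ^ 2 * K x x) μ :=
    integrable_bdd_mul hK.integrable_diag (hh.pow_const 2) (M := M * M)
      fun x => by simpa [sq] using hM2 x x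
  have hdet := hS.ae_nonneg_det_two
  have hG : (fun p : E × E => h p.1 * K p.1 p.1 * (h p.2 * K p.2 p.2)
      - h p.1 * h p.2 * K p.1 p.2 ^ 2) = fun p : E × E => h p.1 * h p.2 *
        (K p.1 p.1 * K p.2 p.2 - K p.1 p.2 * K p.2 p.1) := by
    funext p
    rw [hK.symm p.2 p.1]
    ring
  have hG0 : 0 ≤ᵐ[μ.prod μ] fun p : E × E => h p.1 * h p.2 *
        (K p.1 p.1 * K p.2 p.2 - K p.1 p.2 * K p.2 p.1) := by
    filter_upwards [hdet] with p hp
    exact mul_nonneg (mul_nonneg (h0 _) (h0 _)) hp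
  have e1 : ∫⁻ p, ENNReal.ofReal (h p.1) * ENNReal.ofReal (h p.2) *
        ENNReal.ofReal (K p.1 p.1 * K p.2 p.2 - K p.1 p.2 * K p.2 p.1) ∂(μ.prod μ) =
      ENNReal.ofReal ((∫ x, h x * K x x ∂μ) ^ 2
        - ∫ p, h p.1 * h p.2 * K p.1 p.2 ^ 2 ∂(μ.prod μ)) := by
    rw [sq, ← integral_prod_mul (fun x => h x * K x x) (fun x => h x * K x x),
      ← integral_sub i1 i2, hG, ofReal_integral_eq_lintegral_ofReal (hG ▸ i1.sub i2) hG0]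
    refine lintegral_congr fun p => ?_
    rw [ENNReal.ofReal_mul (mul_nonneg (h0 _) (h0 _)), ENNReal.ofReal_mul (h0 _)]
  have e2 : ∫⁻ x, ENNReal.ofReal (h x) ^ 2 * ENNReal.ofReal (K x x) ∂μ =
      ENNReal.ofReal (∫ x, h x ^ 2 * K x x ∂μ) := by
    rw [ofReal_integral_eq_lintegral_ofReal i3 (Filter.Eventually.of_forall fun x =>
      mul_nonneg (sq_nonneg _) (hK.nonneg_diag x))]
    refine lintegral_congr fun x => ?_
    rw [ENNReal.ofReal_mul (sq_nonneg _), ENNReal.ofReal_pow (h0 _)]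
  have n1 : 0 ≤ (∫ x, h x * K x x ∂μ) ^ 2
        - ∫ p, h p.1 * h p.2 * K p.1 p.2 ^ 2 ∂(μ.prod μ) := by
    rw [sq, ← integral_prod_mul (fun x => h x * K x x) (fun x => h x * K x x),
      ← integral_sub i1 i2, hG]
    exact integral_nonneg_of_ae hG0
  rw [hS.lintegral_tsum_sq hh.ennreal_ofReal, e1, e2, ← ENNReal.ofReal_add n1
    (integral_nonneg fun x => mul_nonneg (sq_nonneg _) (hK.nonneg_diag x)),
    hK.integral_sub_sq hh hMa]
  congr 1
  ring

/-- For h ≥ 0 both moments can be computed in `ℝ≥0∞`, where no summability question arises. -/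
theorem IsDPP.variance_of_nonneg [IsProbabilityMeasure P] (hS : IsDPP P S K μ)
    (hK : IsProjectionKernel K μ)
    {h : E → ℝ} (hh : Measurable h) (h0 : ∀ x, 0 ≤ h x) {M : ℝ} (hM : ∀ x, h x ≤ M) :
    MemLp (linStat S h) 2 P ∧ Var[linStat S h; P] =
        2⁻¹ * ∫ p, (h p.1 - h p.2) ^ 2 * K p.1 p.2 ^ 2 ∂(μ.prod μ) := by
  have hm := hS.isPointProcess.measurable_tsum hh.ennreal_ofReal
  have l1 := hS.lintegral_ofReal hK hh h0 hM
  have l2 := hS.lintegral_sq_ofReal hK hh h0 hM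
  have hL : linStat S h = fun ω => (∑' y : S ω, ENNReal.ofReal (h y)).toReal :=
    funext (linStat_eq_toReal h0)
  have hL2 : (linStat S h) ^ 2 = fun ω => ((∑' y : S ω, ENNReal.ofReal (h y)) ^ 2).toReal := by
    rw [hL]
    funext ω
    simp
  have fin2 : ∫⁻ ω, (∑' y : S ω, ENNReal.ofReal (h y)) ^ 2 ∂P ≠ ∞ := by
    rw [l2]
    exact ENNReal.ofReal_ne_top
  have fin1 : ∫⁻ ω, ∑' y : S ω, ENNReal.ofReal (h y) ∂P ≠ ∞ := by
    rw [l1]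
    exact ENNReal.ofReal_ne_top
  have hmem : MemLp (linStat S h) 2 P := by
    rw [memLp_two_iff_integrable_sq]
    · change Integrable ((linStat S h) ^ 2) P
      rw [hL2]
      exact integrable_toReal_of_lintegral_ne_top (hm.pow_const 2).aemeasurable fin2
    · rw [hL]
      exact hm.ennreal_toReal.aestronglyMeasurable
  refine ⟨hmem, ?_⟩
  rw [variance_eq_sub hmem, hL2, hL, integral_toReal (hm.pow_const 2).aemeasurable
    (ae_lt_top (hm.pow_const 2) fin2), integral_toReal hm.aemeasurable (ae_lt_top hm fin1), l1, l2,
    ENNReal.toReal_ofReal, ENNReal.toReal_ofReal]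
  · ring
  · exact integral_nonneg fun x => mul_nonneg (h0 x) (hK.nonneg_diag x)
  · exact add_nonneg (sq_nonneg _) (mul_nonneg (by norm_num) (integral_nonneg fun p =>
      mul_nonneg (sq_nonneg _) (sq_nonneg _)))

/-- The variance of a bounded linear statistic of a projection determinantal point process. -/
theorem IsDPP.variance_linStat [IsProbabilityMeasure P] (hS : IsDPP P S K μ)
    (hK : IsProjectionKernel K μ)
    {f : E → ℝ} (hf : AEMeasurable f μ) {M : ℝ} (hM0 : 0 ≤ M)
    (hM : ∀ x, |f x| ≤ M) : MemLp (linStat S f) 2 P ∧ Var[linStat S f; P] =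
        2⁻¹ * ∫ p, (f p.1 - f p.2) ^ 2 * K p.1 p.2 ^ 2 ∂(μ.prod μ) := by
  -- Clamping the measurable representative makes it bounded everywhere, without changing it a.e.
  set g : E → ℝ := fun x => max (-M) (min M (hf.mk f x)) with hg
  have hgm : Measurable g := measurable_const.max (measurable_const.min hf.measurable_mk)
  have hfg : f =ᵐ[μ] g := by
    filter_upwards [hf.ae_eq_mk] with x hx
    have := abs_le.1 (hM x)
    simp only [hg, ← hx]
    rw [min_eq_right this.2, max_eq_right this.1]
  -- For h = 1 the Dirichlet form vanishes, so the number of points is a.s. constant. Adding M to g,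
  -- which makes it nonnegative, therefore shifts the statistic by a deterministic amount.
  obtain ⟨m1, v1⟩ := hS.variance_of_nonneg hK (h := fun _ => 1) measurable_const
    (fun _ => zero_le_one) (M := 1) fun _ => le_rfl
  obtain ⟨m2, v2⟩ := hS.variance_of_nonneg hK (h := fun x => g x + M) (hgm.add_const M)
    (fun x => by linarith [le_max_left (-M) (min M (hf.mk f x))]) (M := 2 * M)
    fun x => by
      have : g x ≤ M := max_le (by linarith) (min_le_left _ _)
      linarith
  simp only [sub_self, ne_eq, OfNat.ofNat_ne_zero, not_false_eq_true, zero_pow, zero_mul,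
    integral_zero, mul_zero] at v1
  have hconst := ae_eq_integral_of_variance_eq_zero m1 v1
  set c := ∫ ω, linStat S (fun _ => (1 : ℝ)) ω ∂P
  have hLg : linStat S f =ᵐ[P] fun ω => linStat S (fun x => g x + M) ω - M * c := by
    filter_upwards [hS.ae_linStat_congr hfg, hconst, hS.ae_finite hK] with ω h1 h2 h3
    have : Finite (S ω) := h3
    have : Fintype (S ω) := Fintype.ofFinite _
    rw [h1, ← h2]
    simp only [linStat, tsum_fintype, Finset.sum_add_distrib, Finset.sum_const, nsmul_eq_mul]
    ring
  constructor
  · exact (memLp_congr_ae hLg).2 (m2.sub (memLp_const _))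
  · rw [variance_congr hLg, variance_sub_const m2.aestronglyMeasurable, v2]
    congr 1
    refine integral_congr_ae ?_
    filter_upwards [Measure.quasiMeasurePreserving_fst.ae_eq_comp hfg,
      Measure.quasiMeasurePreserving_snd.ae_eq_comp hfg] with p h1 h2
    simp only [Function.comp] at h1 h2
    rw [h1, h2]
    ring

end ProjectionDPP

/-! ### Orthonormality of the dilated scaling functions on the line. -/

section Scaling

variable {φ : ℝ → ℝ}

theorem dil_neg (φ : ℝ → ℝ) (j : ℕ) (k : ℤ) (x : ℝ) :
    dil φ (-(j : ℤ)) k x = √(2 ^ j) * φ (2 ^ j * x - k) := by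
  have : (2 : ℝ) ^ (-((-(j : ℤ) : ℤ) : ℝ) / 2) = √(2 ^ j) := by
    rw [Real.sqrt_eq_rpow, ← Real.rpow_natCast, ← Real.rpow_mul (by norm_num)]
    congr 1
    push_cast
    ring
  rw [dil, this, neg_neg, zpow_natCast]

theorem IsOrthonormalScaling.memLp (hφ : IsOrthonormalScaling φ) : MemLp φ 2 volume := by
  obtain ⟨V, -, e, he, -, -⟩ := hφ
  have h0 := he 0
  simp only [Int.cast_zero, sub_zero] at h0
  exact (memLp_congr_ae h0).1 (Lp.memLp (e 0))

theorem IsOrthonormalScaling.integral_mul (hφ : IsOrthonormalScaling φ) (k l : ℤ) :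
    ∫ x, φ (x - k) * φ (x - l) = if k = l then 1 else 0 := by
  obtain ⟨V, -, e, he, ho, -⟩ := hφ
  rw [← orthonormal_iff_ite.1 ho k l, L2.inner_def]
  refine integral_congr_ae ?_
  filter_upwards [he k, he l] with x hk hl
  rw [hk, hl]
  simp [mul_comm]

theorem IsOrthonormalScaling.integrable_mul (hφ : IsOrthonormalScaling φ) (k l : ℤ) :
    Integrable fun x => φ (x - k) * φ (x - l) := by
  have h : ∀ m : ℤ, MemLp (fun x => φ (x - m)) 2 volume := fun m =>
    hφ.memLp.comp_measurePreserving (measurePreserving_sub_right volume (m : ℝ))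
  exact (h k).integrable_mul (h l)

theorem IsOrthonormalScaling.integrable_dil_mul (hφ : IsOrthonormalScaling φ) (j : ℕ) (k l : ℤ) :
    Integrable fun x => dil φ (-(j : ℤ)) k x * dil φ (-(j : ℤ)) l x := by
  have h := ((hφ.integrable_mul k l).comp_mul_left' (R := 2 ^ j) (by positivity)).const_mul
    (√(2 ^ j) * √(2 ^ j))
  refine h.congr (Filter.Eventually.of_forall fun x => ?_)
  simp only [dil_neg]
  ring

theorem IsOrthonormalScaling.integral_dil_mul (hφ : IsOrthonormalScaling φ) (j : ℕ) (k l : ℤ) :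
    ∫ x, dil φ (-(j : ℤ)) k x * dil φ (-(j : ℤ)) l x = if k = l then 1 else 0 := by
  have h2 : (0 : ℝ) < 2 ^ j := by positivity
  calc ∫ x, dil φ (-(j : ℤ)) k x * dil φ (-(j : ℤ)) l x
      = ∫ x, 2 ^ j * (φ (2 ^ j * x - k) * φ (2 ^ j * x - l)) := by
        congr 1 with x
        rw [dil_neg, dil_neg, mul_mul_mul_comm, Real.mul_self_sqrt h2.le]
    _ = if k = l then 1 else 0 := by
        rw [integral_const_mul,
          Measure.integral_comp_mul_left (fun x => φ (x - k) * φ (x - l)) (2 ^ j),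
          hφ.integral_mul, abs_of_pos (inv_pos.2 h2), smul_eq_mul, ← mul_assoc,
          mul_inv_cancel₀ h2.ne', one_mul]

end Scaling

/-! ### Tensor products: size, support and rank of the wavelet kernel. -/

section Tensor

variable {d : ℕ}

theorem integral_euclideanSpace_prod (g : Fin d → ℝ → ℝ) :
    ∫ x : EuclideanSpace ℝ (Fin d), ∏ i, g i (x i) = ∏ i, ∫ t, g i t := by
  rw [← integral_fintype_prod_volume_eq_prod,
    ← (PiLp.volume_preserving_ofLp (Fin d)).integral_comp
      (MeasurableEquiv.toLp 2 (Fin d → ℝ)).symm.measurableEmbedding]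

theorem integrable_euclideanSpace_prod {g : Fin d → ℝ → ℝ} (hg : ∀ i, Integrable (g i)) :
    Integrable fun x : EuclideanSpace ℝ (Fin d) => ∏ i, g i (x i) :=
  (PiLp.volume_preserving_ofLp (Fin d)).integrable_comp_of_integrable
    (Integrable.fintype_prod hg)

theorem quasiMeasurePreserving_euclideanSpace_apply (i : Fin d) :
    Measure.QuasiMeasurePreserving (fun x : EuclideanSpace ℝ (Fin d) => x i) volume volume :=
  (Measure.quasiMeasurePreserving_eval (fun _ : Fin d => (volume : Measure ℝ)) i).comp
    (PiLp.volume_preserving_ofLp (Fin d)).quasiMeasurePreserving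

variable {φ : ℝ → ℝ}

theorem IsOrthonormalScaling.memLp_tensorDil (hφ : IsOrthonormalScaling φ) (j : ℕ)
    (k : Fin d → ℤ) : MemLp (tensorDil φ (-(j : ℤ)) k) 2 volume := by
  rw [memLp_two_iff_integrable_sq]
  · refine (integrable_euclideanSpace_prod fun i => hφ.integrable_dil_mul j (k i) (k i)).congr
      (Filter.Eventually.of_forall fun x => ?_)
    simp only [tensorDil, sq, Finset.prod_mul_distrib]
  -- φ is only a.e. measurable, so each map it is composed with (shift, dilation, coordinate) has to
  -- pull null sets back to null sets.
  · refine Finset.aestronglyMeasurable_fun_prod _ fun i _ => ?_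
    have h1 : AEStronglyMeasurable (fun t => dil φ (-(j : ℤ)) (k i) t) volume := by
      have h2 : AEStronglyMeasurable (fun t => φ (t - k i)) volume :=
        hφ.memLp.1.comp_quasiMeasurePreserving
          (measurePreserving_sub_right volume (k i : ℝ)).quasiMeasurePreserving
      have h3 : Measure.QuasiMeasurePreserving (fun t : ℝ => 2 ^ j * t) volume volume := by
        refine ⟨measurable_const_mul _, ?_⟩
        rw [Real.map_volume_mul_left (by positivity)]
        exact Measure.smul_absolutelyContinuous
      simp only [dil_neg]
      exact (h2.comp_quasiMeasurePreserving h3).const_mul _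
    exact h1.comp_quasiMeasurePreserving (quasiMeasurePreserving_euclideanSpace_apply i)

theorem IsOrthonormalScaling.integral_tensorDil_mul (hφ : IsOrthonormalScaling φ) (j : ℕ)
    (k l : Fin d → ℤ) :
    ∫ x, tensorDil φ (-(j : ℤ)) k x * tensorDil φ (-(j : ℤ)) l x = if k = l then 1 else 0 := by
  simp only [tensorDil, ← Finset.prod_mul_distrib]
  rw [integral_euclideanSpace_prod
    fun i t => dil φ (-(j : ℤ)) (k i) t * dil φ (-(j : ℤ)) (l i) t]
  simp only [hφ.integral_dil_mul, Finset.prod_ite_zero, Finset.prod_const_one, Finset.mem_univ,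
    forall_const, funext_iff]

theorem ne_zero_of_tensorDil_ne_zero {j : ℕ} {k : Fin d → ℤ} {x : EuclideanSpace ℝ (Fin d)}
    (h : tensorDil φ (-(j : ℤ)) k x ≠ 0) (i : Fin d) : φ (2 ^ j * x i - k i) ≠ 0 := by
  have := Finset.prod_ne_zero_iff.1 h i (Finset.mem_univ i)
  rw [dil_neg] at this
  exact right_ne_zero_of_mul this

theorem isClosed_closedCube (d : ℕ) : IsClosed (closedCube d) := by
  simp only [closedCube, Set.ofPred_forall]
  exact isClosed_iInter fun i => isClosed_Icc.preimage (by fun_prop)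

/-- The point with coordinates (t + kᵢ)/2^j lies in the support of the k-th function, hence in the
cube; this confines each kᵢ to an interval of length 2^j. -/
theorem indexSet_subset_piFinset {t : ℝ} (ht : φ t ≠ 0) (j : ℕ) :
    indexSet d φ j ⊆ ↑(Fintype.piFinset fun _ : Fin d => Finset.Icc ⌈-t⌉ ⌊(2 : ℝ) ^ j - t⌋) := by
  intro k hk
  have h2 : (0 : ℝ) < 2 ^ j := by positivity
  have hx : (WithLp.toLp 2 fun i => (t + k i) / 2 ^ j : EuclideanSpace ℝ (Fin d))
      ∈ closedCube d := by
    refine hk (subset_tsupport _ ?_)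
    rw [Function.mem_support, tensorDil, Finset.prod_ne_zero_iff]
    intro i _
    rw [dil_neg]
    refine mul_ne_zero (Real.sqrt_pos.2 h2).ne' ?_
    convert ht using 2
    simp only
    field_simp
    ring
  rw [Finset.mem_coe, Fintype.mem_piFinset]
  intro i
  have h1 := hx i
  simp only [Set.mem_Icc] at h1
  rw [le_div_iff₀ h2, div_le_iff₀ h2] at h1
  rw [Finset.mem_Icc, Int.ceil_le, Int.le_floor]
  constructor <;> linarith

theorem piFinset_subset_indexSet {R : ℝ} (hR : ∀ x, φ x ≠ 0 → |x| ≤ R) (j : ℕ) :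
    ↑(Fintype.piFinset fun _ : Fin d => Finset.Icc ⌈R⌉ ⌊(2 : ℝ) ^ j - R⌋) ⊆ indexSet d φ j := by
  intro k hk
  rw [Finset.mem_coe, Fintype.mem_piFinset] at hk
  refine closure_minimal (fun x hx i => ?_) (isClosed_closedCube d)
  have h2 : (0 : ℝ) < 2 ^ j := by positivity
  have h1 := abs_le.1 (hR _ (ne_zero_of_tensorDil_ne_zero hx i))
  have h3 := hk i
  rw [Finset.mem_Icc, Int.ceil_le, Int.le_floor] at h3
  constructor
  · exact nonneg_of_mul_nonneg_right (by linarith : 0 ≤ 2 ^ j * x i) h2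
  · exact le_of_mul_le_mul_left (by linarith : 2 ^ j * x i ≤ 2 ^ j * 1) h2

/-- The hypothesis keeps the right side nonnegative, which covers the case of an empty interval. -/
theorem card_Icc_ceil_floor_le {a b : ℝ} (hab : a ≤ b + 1) :
    ((Finset.Icc ⌈a⌉ ⌊b⌋).card : ℝ) ≤ b - a + 1 := by
  rw [Int.card_Icc]
  have h1 := Int.floor_le b
  have h2 := Int.le_ceil a
  have h3 : (((⌊b⌋ + 1 - ⌈a⌉).toNat : ℤ) : ℝ) = ((max (⌊b⌋ + 1 - ⌈a⌉) 0 : ℤ) : ℝ) := by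
    rw [Int.ofNat_toNat]
  rw [Int.cast_natCast] at h3
  rw [h3]
  push_cast
  exact max_le (by linarith) (by linarith)

theorem le_card_Icc_ceil_floor (a b : ℝ) :
    b - a - 1 ≤ ((Finset.Icc ⌈a⌉ ⌊b⌋).card : ℝ) := by
  rw [Int.card_Icc]
  have h1 := Int.sub_one_lt_floor b
  have h2 := Int.ceil_lt_add_one a
  have h3 : (((⌊b⌋ + 1 - ⌈a⌉).toNat : ℤ) : ℝ) = ((max (⌊b⌋ + 1 - ⌈a⌉) 0 : ℤ) : ℝ) := by
    rw [Int.ofNat_toNat]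
  rw [Int.cast_natCast] at h3
  rw [h3]
  push_cast
  exact le_max_of_le_left (by linarith)

theorem indexSet_finite {t : ℝ} (ht : φ t ≠ 0) (j : ℕ) : (indexSet d φ j).Finite :=
  (Finset.finite_toSet _).subset (indexSet_subset_piFinset ht j)

theorem numPoints_le {t : ℝ} (ht : φ t ≠ 0) (j : ℕ) :
    (numPoints d φ j : ℝ) ≤ 2 ^ d * (2 ^ j : ℝ) ^ d := by
  have h1 := Set.ncard_le_ncard (indexSet_subset_piFinset (d := d) ht j) (Finset.finite_toSet _)
  rw [Set.ncard_coe_finset, Fintype.card_piFinset, Finset.prod_const, Finset.card_univ,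
    Fintype.card_fin] at h1
  have h2 : (1 : ℝ) ≤ 2 ^ j := one_le_pow₀ one_le_two
  calc (numPoints d φ j : ℝ) ≤ ((Finset.Icc ⌈-t⌉ ⌊(2 : ℝ) ^ j - t⌋).card : ℝ) ^ d := by
        exact_mod_cast h1
    _ ≤ (2 * 2 ^ j) ^ d := by
        refine pow_le_pow_left₀ (by positivity) ?_ d
        refine (card_Icc_ceil_floor_le (by linarith)).trans (by linarith)
    _ = _ := mul_pow _ _ _

/-- On coarse scales, 2^j ≤ 2R + 2, the left side is at most 1 and n ≥ 1 suffices. On finer scales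
at least 2^j - 2R - 1 ≥ 2^j/(2R + 2) admissible values remain per coordinate. -/
theorem le_numPoints {t : ℝ} (ht : φ t ≠ 0) {R : ℝ} (hR0 : 0 ≤ R) (hR : ∀ x, φ x ≠ 0 → |x| ≤ R)
    {j : ℕ} (hn : 1 ≤ numPoints d φ j) :
    ((2 * R + 2) ^ d)⁻¹ * (2 ^ j : ℝ) ^ d ≤ numPoints d φ j := by
  rw [← inv_pow, ← mul_pow, inv_mul_eq_div]
  have h0 : (0 : ℝ) < 2 ^ j := by positivity
  rcases le_total ((2 : ℝ) ^ j) (2 * R + 2) with h | h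
  · calc ((2 : ℝ) ^ j / (2 * R + 2)) ^ d ≤ 1 :=
          pow_le_one₀ (by positivity) ((div_le_one (by positivity)).2 h)
      _ ≤ numPoints d φ j := by exact_mod_cast hn
  · have h1 := Set.ncard_le_ncard (piFinset_subset_indexSet (d := d) hR j) (indexSet_finite ht j)
    rw [Set.ncard_coe_finset, Fintype.card_piFinset, Finset.prod_const, Finset.card_univ,
      Fintype.card_fin] at h1
    calc ((2 : ℝ) ^ j / (2 * R + 2)) ^ d
        ≤ ((Finset.Icc ⌈R⌉ ⌊(2 : ℝ) ^ j - R⌋).card : ℝ) ^ d := by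
          refine pow_le_pow_left₀ (by positivity) (le_trans ?_ (le_card_Icc_ceil_floor _ _)) d
          rw [div_le_iff₀ (by positivity)]
          nlinarith
      _ ≤ numPoints d φ j := by exact_mod_cast h1

theorem waveletKernel_eq_sum {t : ℝ} (ht : φ t ≠ 0) (j : ℕ) :
    waveletKernel d φ j = fun x y => ∑ k ∈ (indexSet_finite (d := d) ht j).toFinset,
      tensorDil φ (-(j : ℤ)) k x * tensorDil φ (-(j : ℤ)) k y := by
  funext x y
  exact finsum_mem_eq_finite_toFinset_sum _ _

theorem exists_of_waveletKernel_ne_zero {j : ℕ} {x y : EuclideanSpace ℝ (Fin d)}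
    (h : waveletKernel d φ j x y ≠ 0) : ∃ k ∈ indexSet d φ j,
      tensorDil φ (-(j : ℤ)) k x ≠ 0 ∧ tensorDil φ (-(j : ℤ)) k y ≠ 0 := by
  obtain ⟨k, hk, h⟩ := exists_ne_zero_of_finsum_mem_ne_zero h
  exact ⟨k, hk, left_ne_zero_of_mul h, right_ne_zero_of_mul h⟩

theorem mem_closedCube_of_waveletKernel_ne_zero {j : ℕ} {x y : EuclideanSpace ℝ (Fin d)}
    (h : waveletKernel d φ j x y ≠ 0) : x ∈ closedCube d ∧ y ∈ closedCube d := by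
  obtain ⟨k, hk, hx, hy⟩ := exists_of_waveletKernel_ne_zero h
  exact ⟨hk (subset_tsupport _ hx), hk (subset_tsupport _ hy)⟩

/-- Some basis function is nonzero at both points, and its support lies in a box of side 2R/2^j; the
factor √d from the Euclidean norm is enlarged to d. -/
theorem norm_sub_le_of_waveletKernel_ne_zero {R : ℝ} (hR : ∀ x, φ x ≠ 0 → |x| ≤ R) {j : ℕ}
    {x y : EuclideanSpace ℝ (Fin d)} (h : waveletKernel d φ j x y ≠ 0) :
    ‖x - y‖ ≤ 2 * R * d / 2 ^ j := by
  obtain ⟨k, -, hx, hy⟩ := exists_of_waveletKernel_ne_zero h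
  have h2 : (0 : ℝ) < 2 ^ j := by positivity
  have hi : ∀ i, |x i - y i| ≤ 2 * R / 2 ^ j := fun i => by
    have h1 := abs_le.1 (hR _ (ne_zero_of_tensorDil_ne_zero hx i))
    have h3 := abs_le.1 (hR _ (ne_zero_of_tensorDil_ne_zero hy i))
    rw [abs_le, neg_le, ← neg_sub, neg_neg, le_div_iff₀ h2, le_div_iff₀ h2]
    constructor <;> linarith
  rcases Nat.eq_zero_or_pos d with rfl | hd
  · simp [Subsingleton.elim x y]
  have hR0 : 0 ≤ 2 * R / 2 ^ j := (abs_nonneg _).trans (hi ⟨0, hd⟩)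
  have hd1 : (1 : ℝ) ≤ d := by exact_mod_cast hd
  rw [EuclideanSpace.norm_eq]
  refine Real.sqrt_le_iff.2 ⟨by rw [mul_div_right_comm]; positivity, ?_⟩
  calc ∑ i, ‖(x - y) i‖ ^ 2 ≤ ∑ _i : Fin d, (2 * R / 2 ^ j) ^ 2 :=
        Finset.sum_le_sum fun i _ => pow_le_pow_left₀ (norm_nonneg _) (hi i) 2
    _ = d * (2 * R / 2 ^ j) ^ 2 := by simp
    _ ≤ d * d * (2 * R / 2 ^ j) ^ 2 :=
        mul_le_mul_of_nonneg_right (by nlinarith) (sq_nonneg _)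
    _ = _ := by ring

theorem abs_tensorDil_le {M : ℝ} (hM : ∀ x, |φ x| ≤ M) (j : ℕ) (k : Fin d → ℤ)
    (x : EuclideanSpace ℝ (Fin d)) : |tensorDil φ (-(j : ℤ)) k x| ≤ (√(2 ^ j) * M) ^ d := by
  rw [tensorDil, Finset.abs_prod]
  calc ∏ i, |dil φ (-(j : ℤ)) (k i) (x i)| ≤ ∏ _i : Fin d, (√(2 ^ j) * M) := by
        refine Finset.prod_le_prod (fun _ _ => abs_nonneg _) fun i _ => ?_
        rw [dil_neg, abs_mul, abs_of_nonneg (Real.sqrt_nonneg _)]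
        exact mul_le_mul_of_nonneg_left (hM _) (Real.sqrt_nonneg _)
    _ = _ := by simp

/-- At a given x at most (2R + 1)^d basis functions are nonzero, so the bound does not grow with the
number of indices. -/
theorem abs_waveletKernel_le {t : ℝ} (ht : φ t ≠ 0) {R : ℝ} (hR0 : 0 ≤ R)
    (hR : ∀ x, φ x ≠ 0 → |x| ≤ R) {M : ℝ} (hM : ∀ x, |φ x| ≤ M) (j : ℕ)
    (x y : EuclideanSpace ℝ (Fin d)) :
    |waveletKernel d φ j x y| ≤ ((2 * R + 1) * M ^ 2) ^ d * (2 ^ j : ℝ) ^ d := by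
  have hM0 : 0 ≤ M := (abs_nonneg _).trans (hM 0)
  have h2 : (0 : ℝ) < 2 ^ j := by positivity
  set J := Fintype.piFinset fun i : Fin d =>
    Finset.Icc ⌈(2 : ℝ) ^ j * x i - R⌉ ⌊(2 : ℝ) ^ j * x i + R⌋ with hJ
  have hterm : ∀ k : Fin d → ℤ, k ∉ J →
      |tensorDil φ (-(j : ℤ)) k x * tensorDil φ (-(j : ℤ)) k y| = 0 := by
    intro k hk
    by_contra hne
    refine hk (Fintype.mem_piFinset.2 fun i => ?_)
    have h1 := abs_le.1 (hR _ (ne_zero_of_tensorDil_ne_zero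
      (left_ne_zero_of_mul (abs_ne_zero.1 hne)) i))
    rw [Finset.mem_Icc, Int.ceil_le, Int.le_floor]
    constructor <;> linarith
  have hcard : (J.card : ℝ) ≤ (2 * R + 1) ^ d := by
    rw [hJ, Fintype.card_piFinset, Nat.cast_prod]
    calc ∏ i : Fin d, ((Finset.Icc ⌈(2 : ℝ) ^ j * x i - R⌉ ⌊(2 : ℝ) ^ j * x i + R⌋).card : ℝ)
        ≤ ∏ _i : Fin d, (2 * R + 1) :=
          Finset.prod_le_prod (fun _ _ => by positivity) fun i _ =>
            (card_Icc_ceil_floor_le (by linarith)).trans (by linarith)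
      _ = _ := by simp
  rw [waveletKernel_eq_sum ht]
  set I := (indexSet_finite (d := d) ht j).toFinset
  calc |∑ k ∈ I, tensorDil φ (-(j : ℤ)) k x * tensorDil φ (-(j : ℤ)) k y|
      ≤ ∑ k ∈ I, |tensorDil φ (-(j : ℤ)) k x * tensorDil φ (-(j : ℤ)) k y| :=
        Finset.abs_sum_le_sum_abs _ _
    _ = ∑ k ∈ I ∩ J, |tensorDil φ (-(j : ℤ)) k x * tensorDil φ (-(j : ℤ)) k y| := by
        symm
        refine Finset.sum_subset Finset.inter_subset_left fun k hk hkJ => hterm k fun h => ?_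
        exact hkJ (Finset.mem_inter.2 ⟨hk, h⟩)
    _ ≤ ∑ k ∈ J, |tensorDil φ (-(j : ℤ)) k x * tensorDil φ (-(j : ℤ)) k y| :=
        Finset.sum_le_sum_of_subset_of_nonneg Finset.inter_subset_right
          fun _ _ _ => abs_nonneg _
    _ ≤ ∑ _k ∈ J, (√(2 ^ j) * M) ^ d * (√(2 ^ j) * M) ^ d := by
        refine Finset.sum_le_sum fun k _ => ?_
        rw [abs_mul]
        exact mul_le_mul (abs_tensorDil_le hM j k x) (abs_tensorDil_le hM j k y)
          (abs_nonneg _) (by positivity)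
    _ = J.card * ((2 ^ j) ^ d * (M ^ 2) ^ d) := by
        rw [Finset.sum_const, nsmul_eq_mul, ← mul_pow, ← mul_pow]
        congr 2
        rw [mul_mul_mul_comm, Real.mul_self_sqrt h2.le]
        ring
    _ ≤ (2 * R + 1) ^ d * ((2 ^ j) ^ d * (M ^ 2) ^ d) :=
        mul_le_mul_of_nonneg_right hcard (by positivity)
    _ = _ := by rw [mul_pow]; ring

theorem IsOrthonormalScaling.isProjectionKernel (hφ : IsOrthonormalScaling φ) {t : ℝ}
    (ht : φ t ≠ 0) (j : ℕ) : IsProjectionKernel (waveletKernel d φ j) volume := by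
  rw [waveletKernel_eq_sum ht]
  exact .of_orthonormal _ _ (fun k _ => hφ.memLp_tensorDil j k)
    fun k _ l _ => hφ.integral_tensorDil_mul j k l

/-- The squared Hilbert–Schmidt norm of a projection is its trace, that is, its rank. -/
theorem IsOrthonormalScaling.integral_waveletKernel_sq (hφ : IsOrthonormalScaling φ) {t : ℝ}
    (ht : φ t ≠ 0) (j : ℕ) :
    ∫ p : EuclideanSpace ℝ (Fin d) × EuclideanSpace ℝ (Fin d), waveletKernel d φ j p.1 p.2 ^ 2
      = numPoints d φ j := by
  have hK := hφ.isProjectionKernel (d := d) ht j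
  rw [Measure.volume_eq_prod, integral_prod _ hK.integrable_sq]
  simp_rw [hK.integral_sq]
  simp only [waveletKernel_eq_sum ht]
  rw [integral_finsetSum (f := fun (k : Fin d → ℤ) x => _ * _) _ fun k _ =>
    (hφ.memLp_tensorDil (d := d) j k).integrable_mul (hφ.memLp_tensorDil j k)]
  simp_rw [hφ.integral_tensorDil_mul]
  rw [numPoints, Set.ncard_eq_toFinset_card _ (indexSet_finite (d := d) ht j)]
  simp

end Tensor

/-! ### Increments of mollified Sobolev functions. -/

section Sobolev

open Filter Topology ContinuousLinearMap
open scoped Convolution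

/-- Cauchy–Schwarz against the constant 1, for a measure of mass at most 1. -/
theorem lintegral_sq_le {α : Type*} [MeasurableSpace α] {ν : Measure α} (hν : ν Set.univ ≤ 1)
    {F : α → ℝ≥0∞} (hF : AEMeasurable F ν) : (∫⁻ x, F x ∂ν) ^ 2 ≤ ∫⁻ x, F x ^ 2 ∂ν := by
  have h := ENNReal.lintegral_mul_le_Lp_mul_Lq ν Real.HolderConjugate.two_two hF
    (aemeasurable_const (b := (1 : ℝ≥0∞)))
  simp only [Pi.mul_apply, mul_one, ENNReal.one_rpow, lintegral_const, one_mul] at h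
  have h1 : ν Set.univ ^ (1 / 2 : ℝ) ≤ 1 := ENNReal.rpow_le_one hν (by norm_num)
  have h2 := h.trans (mul_le_of_le_one_right' h1)
  calc (∫⁻ x, F x ∂ν) ^ 2 ≤ ((∫⁻ x, F x ^ (2 : ℝ) ∂ν) ^ (1 / 2 : ℝ)) ^ 2 :=
        pow_le_pow_left' h2 2
    _ = ∫⁻ x, F x ^ 2 ∂ν := by
        rw [← ENNReal.rpow_natCast, ← ENNReal.rpow_mul]
        norm_num

variable {d : ℕ} {U : Set (EuclideanSpace ℝ (Fin d))} {f : EuclideanSpace ℝ (Fin d) → ℝ}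
  {g : EuclideanSpace ℝ (Fin d) → EuclideanSpace ℝ (Fin d)}

theorem HasSobolevGradient.integral_mul_fderiv (hfg : HasSobolevGradient U f g)
    {ψ : EuclideanSpace ℝ (Fin d) → ℝ} (hψ : ContDiff ℝ (⊤ : ℕ∞) ψ) (hc : HasCompactSupport ψ)
    (hU : tsupport ψ ⊆ U) (h : EuclideanSpace ℝ (Fin d)) :
    ∫ x in U, f x * fderiv ℝ ψ x h = - ∫ x in U, ψ x * inner ℝ (g x) h := by
  have hh : h = ∑ i, h i • EuclideanSpace.single i (1 : ℝ) := by
    ext j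
    simp [Finset.sum_apply, Pi.single_apply]
  have hψ2 : MemLp ψ 2 (volume.restrict U) :=
    (hψ.continuous.memLp_of_hasCompactSupport hc).restrict U
  have i1 : ∀ i, Integrable (fun x => h i * (f x * fderiv ℝ ψ x (EuclideanSpace.single i 1)))
      (volume.restrict U) := fun i => by
    refine Integrable.const_mul (hfg.memLp.integrable_mul (q := 2) ?_) _
    refine (Continuous.memLp_of_hasCompactSupport ?_ ?_).restrict U
    · exact (hψ.continuous_fderiv (by simp)).clm_apply continuous_const
    · exact (hc.fderiv ℝ).comp_left (g := fun L => L (EuclideanSpace.single i 1)) rfl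
  have i2 : ∀ i, Integrable (fun x => h i * (g x i * ψ x)) (volume.restrict U) := fun i => by
    refine Integrable.const_mul (MemLp.integrable_mul (p := 2) (q := 2) ?_ hψ2) _
    exact (EuclideanSpace.proj (𝕜 := ℝ) i).comp_memLp' hfg.memLp_grad
  calc ∫ x in U, f x * fderiv ℝ ψ x h
      = ∫ x in U, ∑ i, h i * (f x * fderiv ℝ ψ x (EuclideanSpace.single i 1)) := by
        congr 1 with x
        conv_lhs => rw [hh]
        simp only [map_sum, map_smul, smul_eq_mul, Finset.mul_sum]
        exact Finset.sum_congr rfl fun i _ => by ring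
    _ = ∑ i, h i * -∫ x in U, g x i * ψ x := by
        rw [integral_finsetSum _ fun i _ => i1 i]
        refine Finset.sum_congr rfl fun i _ => ?_
        rw [integral_const_mul, hfg.weak_deriv i ψ hψ hc hU]
    _ = - ∫ x in U, ∑ i, h i * (g x i * ψ x) := by
        rw [integral_finsetSum _ fun i _ => i2 i, ← Finset.sum_neg_distrib]
        refine Finset.sum_congr rfl fun i _ => ?_
        rw [integral_const_mul, mul_neg]
    _ = _ := by
        congr 2 with x
        rw [PiLp.inner_apply, Finset.mul_sum]
        refine Finset.sum_congr rfl fun i _ => ?_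
        simp
        ring

/-- The derivative is put on the bump; as the ball lies in U, y ↦ η(x - y) is an admissible test
function in the definition of the weak gradient. -/
theorem HasSobolevGradient.fderiv_convolution (hfg : HasSobolevGradient U f g)
    (hf0 : ∀ x, x ∉ U → f x = 0) (hfl : LocallyIntegrable f volume)
    (b : ContDiffBump (0 : EuclideanSpace ℝ (Fin d))) {x : EuclideanSpace ℝ (Fin d)}
    (hx : Metric.closedBall x b.rOut ⊆ U) (h : EuclideanSpace ℝ (Fin d)) :
    fderiv ℝ (b.normed volume ⋆[lsmul ℝ ℝ, volume] f) x h =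
      ∫ y in U, b.normed volume (x - y) * inner ℝ (g y) h := by
  have hη : ContDiff ℝ (⊤ : ℕ∞) (b.normed volume) := b.contDiff_normed
  have hη1 : ContDiff ℝ 1 (b.normed volume) := hη.of_le (by simp)
  have hc : HasCompactSupport (b.normed (volume : Measure (EuclideanSpace ℝ (Fin d)))) :=
    b.hasCompactSupport_normed
  rw [(hc.hasFDerivAt_convolution_left (lsmul ℝ ℝ) hη1 hfl x).fderiv, convolution_eq_swap]
  have hex := ((hc.fderiv ℝ).convolutionExists_left ((lsmul ℝ ℝ : ℝ →L[ℝ] ℝ →L[ℝ] ℝ).precompL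
    (EuclideanSpace ℝ (Fin d))) (hη1.continuous_fderiv one_ne_zero) hfl x).integrable_swap
  rw [ContinuousLinearMap.integral_apply hex]
  set ψ : EuclideanSpace ℝ (Fin d) → ℝ := fun y => b.normed volume (x - y) with hψ
  have hsub : Function.support ψ ⊆ Metric.closedBall x b.rOut := by
    intro y hy
    have : x - y ∈ Function.support (b.normed (volume : Measure (EuclideanSpace ℝ (Fin d)))) := hy
    rw [b.support_normed_eq, mem_ball_zero_iff] at this
    rw [mem_closedBall_iff_norm']
    exact this.le
  have hψs : tsupport ψ ⊆ U := (closure_minimal hsub Metric.isClosed_closedBall).trans hx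
  have hψc : HasCompactSupport ψ :=
    HasCompactSupport.of_support_subset_isCompact (isCompact_closedBall x b.rOut) hsub
  have hψd : ContDiff ℝ (⊤ : ℕ∞) ψ := hη.comp (contDiff_const.sub contDiff_id)
  -- The sign from differentiating y ↦ x - y cancels the sign of the integration by parts.
  have hder : ∀ y, fderiv ℝ ψ y h = - fderiv ℝ (b.normed volume) (x - y) h := fun y => by
    have := ((hη1.differentiable one_ne_zero).differentiableAt (x := x - y)).hasFDerivAt.comp y
      ((hasFDerivAt_id (𝕜 := ℝ) y).const_sub x)
    rw [show ψ = b.normed volume ∘ HSub.hSub x from rfl, this.fderiv]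
    simp
  have key := hfg.integral_mul_fderiv hψd hψc hψs h
  simp_rw [hder, mul_neg, integral_neg, neg_inj] at key
  rw [← key, setIntegral_eq_integral_of_forall_compl_eq_zero]
  · congr 1 with y
    simp [mul_comm]
  · intro y hy
    rw [hf0 y hy, zero_mul]

theorem lintegral_ofReal_normed_sub (b : ContDiffBump (0 : EuclideanSpace ℝ (Fin d)))
    (x : EuclideanSpace ℝ (Fin d)) :
    ∫⁻ y, ENNReal.ofReal (b.normed volume (x - y)) = 1 := by
  rw [lintegral_sub_left_eq_self (fun y => ENNReal.ofReal (b.normed volume y)) x,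
    ← ofReal_integral_eq_lintegral_ofReal b.integrable_normed
      (Eventually.of_forall b.nonneg_normed), b.integral_normed, ENNReal.ofReal_one]

/-- The fundamental theorem of calculus along the segment from x to x + h, then `lintegral_sq_le`
twice: in t, and against the bump as a density. A measurable γ in place of ‖g‖ prepares for Tonelli.
-/
theorem HasSobolevGradient.enorm_sub_convolution_sq_le (hfg : HasSobolevGradient U f g)
    (hf0 : ∀ x, x ∉ U → f x = 0) (hfl : LocallyIntegrable f volume)
    (b : ContDiffBump (0 : EuclideanSpace ℝ (Fin d))) {x h : EuclideanSpace ℝ (Fin d)}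
    (hx : ∀ t ∈ Set.Icc (0 : ℝ) 1, Metric.closedBall (x + t • h) b.rOut ⊆ U)
    {γ : EuclideanSpace ℝ (Fin d) → ℝ≥0∞} (hγ : Measurable γ)
    (hgγ : (fun y => ‖g y‖ₑ) =ᵐ[volume.restrict U] γ) :
    ‖(b.normed volume ⋆[lsmul ℝ ℝ, volume] f) (x + h) -
        (b.normed volume ⋆[lsmul ℝ ℝ, volume] f) x‖ₑ ^ 2 ≤
      ∫⁻ t in Set.Ioc (0 : ℝ) 1, ∫⁻ y in U,
        ENNReal.ofReal (b.normed volume (x + t • h - y)) * (γ y * ‖h‖ₑ) ^ 2 := by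
  set F : EuclideanSpace ℝ (Fin d) → ℝ := b.normed volume ⋆[lsmul ℝ ℝ, volume] f with hF
  have hη : ContDiff ℝ (⊤ : ℕ∞) (b.normed volume) := b.contDiff_normed
  have hc : HasCompactSupport (b.normed (volume : Measure (EuclideanSpace ℝ (Fin d)))) :=
    b.hasCompactSupport_normed
  have hF1 : ContDiff ℝ 1 F := hc.contDiff_convolution_left (lsmul ℝ ℝ) (hη.of_le (by simp)) hfl
  have hcont : Continuous fun t : ℝ => fderiv ℝ F (x + t • h) h :=
    ((hF1.continuous_fderiv one_ne_zero).comp (by fun_prop)).clm_apply continuous_const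
  have hder : ∀ t : ℝ, HasDerivAt (fun t : ℝ => F (x + t • h)) (fderiv ℝ F (x + t • h) h) t := by
    intro t
    have h1 : HasDerivAt (fun t : ℝ => x + t • h) h t := by
      simpa using ((hasDerivAt_id t).smul_const h).const_add x
    exact ((hF1.differentiable one_ne_zero).differentiableAt.hasFDerivAt).comp_hasDerivAt t h1
  have hint : F (x + h) - F x = ∫ t in Set.Ioc (0 : ℝ) 1, fderiv ℝ F (x + t • h) h := by
    rw [← intervalIntegral.integral_of_le zero_le_one,
      intervalIntegral.integral_eq_sub_of_hasDerivAt (fun t _ => hder t)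
        (hcont.intervalIntegrable _ _)]
    simp
  calc ‖F (x + h) - F x‖ₑ ^ 2
      ≤ (∫⁻ t in Set.Ioc (0 : ℝ) 1, ‖fderiv ℝ F (x + t • h) h‖ₑ) ^ 2 := by
        rw [hint]
        exact pow_le_pow_left' (enorm_integral_le_lintegral_enorm _) 2
    _ ≤ ∫⁻ t in Set.Ioc (0 : ℝ) 1, ‖fderiv ℝ F (x + t • h) h‖ₑ ^ 2 :=
        lintegral_sq_le (by simp) hcont.measurable.enorm.aemeasurable
    _ ≤ _ := by
        refine setLIntegral_mono' measurableSet_Ioc fun t ht => ?_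
        rw [hfg.fderiv_convolution hf0 hfl b (hx t (Set.Ioc_subset_Icc_self ht)) h]
        have hηm : Measurable fun y => ENNReal.ofReal (b.normed volume (x + t • h - y)) :=
          (b.continuous_normed.comp (by fun_prop)).measurable.ennreal_ofReal
        have hγm : Measurable fun y => γ y * ‖h‖ₑ := hγ.mul_const _
        calc ‖∫ y in U, b.normed volume (x + t • h - y) * inner ℝ (g y) h‖ₑ ^ 2
            ≤ (∫⁻ y in U, ENNReal.ofReal (b.normed volume (x + t • h - y)) * (γ y * ‖h‖ₑ)) ^ 2 := by
              refine pow_le_pow_left' ((enorm_integral_le_lintegral_enorm _).trans ?_) 2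
              refine lintegral_mono_ae ?_
              filter_upwards [hgγ] with y hy
              rw [enorm_mul, Real.enorm_of_nonneg (b.nonneg_normed _), ← hy]
              gcongr
              rw [← ofReal_norm, ← ofReal_norm, ← ofReal_norm,
                ← ENNReal.ofReal_mul (norm_nonneg _)]
              exact ENNReal.ofReal_le_ofReal (norm_inner_le_norm _ _)
          _ = (∫⁻ y, (γ y * ‖h‖ₑ) ∂((volume.restrict U).withDensity
                fun y => ENNReal.ofReal (b.normed volume (x + t • h - y)))) ^ 2 := by
              rw [lintegral_withDensity_eq_lintegral_mul _ hηm hγm]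
              rfl
          _ ≤ ∫⁻ y, (γ y * ‖h‖ₑ) ^ 2 ∂((volume.restrict U).withDensity
                fun y => ENNReal.ofReal (b.normed volume (x + t • h - y))) := by
              refine lintegral_sq_le ?_ hγm.aemeasurable
              rw [withDensity_apply _ MeasurableSet.univ, Measure.restrict_univ,
                ← lintegral_ofReal_normed_sub b (x + t • h)]
              exact setLIntegral_le_lintegral _ _
          _ = _ := by
              rw [lintegral_withDensity_eq_lintegral_mul _ hηm (hγm.pow_const 2)]
              rfl

/-- By Tonelli x can be integrated before y; the translated bump then has mass 1 whatever t and y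
are. -/
theorem lintegral_lintegral_normed_mul_le (b : ContDiffBump (0 : EuclideanSpace ℝ (Fin d)))
    (h : EuclideanSpace ℝ (Fin d)) {γ : EuclideanSpace ℝ (Fin d) → ℝ≥0∞} (hγ : Measurable γ) :
    ∫⁻ x, ∫⁻ t in Set.Ioc (0 : ℝ) 1, ∫⁻ y in U,
        ENNReal.ofReal (b.normed volume (x + t • h - y)) * (γ y * ‖h‖ₑ) ^ 2 =
      ‖h‖ₑ ^ 2 * ∫⁻ y in U, γ y ^ 2 := by
  have hm : Measurable fun p : (EuclideanSpace ℝ (Fin d) × ℝ) × EuclideanSpace ℝ (Fin d) =>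
      ENNReal.ofReal (b.normed volume (p.1.1 + p.1.2 • h - p.2)) * (γ p.2 * ‖h‖ₑ) ^ 2 :=
    ((b.continuous_normed.comp (by fun_prop)).measurable.ennreal_ofReal).mul
      (((hγ.comp measurable_snd).mul_const _).pow_const 2)
  rw [lintegral_lintegral_swap]
  · have key : ∀ t : ℝ, ∫⁻ x, ∫⁻ y in U,
        ENNReal.ofReal (b.normed volume (x + t • h - y)) * (γ y * ‖h‖ₑ) ^ 2 =
          ‖h‖ₑ ^ 2 * ∫⁻ y in U, γ y ^ 2 := by
      intro t
      rw [lintegral_lintegral_swap]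
      · rw [← lintegral_const_mul _ (hγ.pow_const 2)]
        refine lintegral_congr fun y => ?_
        have hη : Measurable fun x => ENNReal.ofReal (b.normed volume (x + t • h - y)) :=
          (b.continuous_normed.comp (by fun_prop)).measurable.ennreal_ofReal
        rw [lintegral_mul_const _ hη]
        have : ∫⁻ x, ENNReal.ofReal (b.normed volume (x + t • h - y)) = 1 := by
          have h1 := lintegral_sub_right_eq_self (μ := volume)
            (fun x => ENNReal.ofReal (b.normed volume x)) (y - t • h)
          have h2 := lintegral_ofReal_normed_sub b 0
          simp_rw [zero_sub, b.normed_neg] at h2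
          rw [← h2, ← h1]
          refine lintegral_congr fun x => ?_
          congr 2
          abel
        rw [this, one_mul, mul_pow, mul_comm]
      · exact (hm.comp (f := fun p : EuclideanSpace ℝ (Fin d) × EuclideanSpace ℝ (Fin d) =>
          ((p.1, t), p.2)) (by fun_prop)).aemeasurable
    simp_rw [key]
    simp
  · exact (Measurable.lintegral_prod_right' hm).aemeasurable

end Sobolev

/-! ### The unit cube and the translation estimate in H¹. -/

section Cube

open Filter Topology ContinuousLinearMap
open scoped Convolution

theorem isOpen_openCube (d : ℕ) : IsOpen (openCube d) := by
  simp only [openCube, Set.ofPred_forall]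
  exact isOpen_iInter_of_finite fun i => isOpen_Ioo.preimage (by fun_prop)

theorem openCube_eq_preimage (d : ℕ) :
    openCube d = WithLp.ofLp ⁻¹' (Set.univ.pi fun _ : Fin d => Set.Ioo (0 : ℝ) 1) := by
  ext x
  simp [openCube]

theorem closedCube_eq_preimage (d : ℕ) :
    closedCube d = WithLp.ofLp ⁻¹' (Set.Icc (0 : Fin d → ℝ) 1) := by
  ext x
  simp [closedCube, Pi.le_def, forall_and]

/-- Reconciles the kernel, supported in the closed cube, with the Sobolev seminorms, taken over the
open one. -/
theorem openCube_ae_eq_closedCube (d : ℕ) : openCube d =ᵐ[volume] closedCube d := by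
  rw [openCube_eq_preimage, closedCube_eq_preimage]
  exact (PiLp.volume_preserving_ofLp (Fin d)).quasiMeasurePreserving.preimage_ae_eq
    (Measure.univ_pi_Ioo_ae_eq_Icc (f := 0) (g := 1))

theorem volume_openCube (d : ℕ) : volume (openCube d) = 1 := by
  rw [openCube_eq_preimage, (PiLp.volume_preserving_ofLp (Fin d)).measure_preimage
    (MeasurableSet.univ_pi fun _ => measurableSet_Ioo).nullMeasurableSet, Real.volume_pi_Ioo]
  simp

variable {d : ℕ} {f : EuclideanSpace ℝ (Fin d) → ℝ}
  {g : EuclideanSpace ℝ (Fin d) → EuclideanSpace ℝ (Fin d)}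

theorem integrable_of_memLp_openCube (hf0 : ∀ x, x ∉ openCube d → f x = 0)
    (hf : MemLp f 2 (volume.restrict (openCube d))) : Integrable f := by
  have : IsFiniteMeasure ((volume : Measure (EuclideanSpace ℝ (Fin d))).restrict (openCube d)) :=
    ⟨by simp [volume_openCube]⟩
  exact (integrableOn_iff_integrable_of_support_subset
    fun x hx => by_contra fun h => hx (hf0 x h)).1 (hf.integrable one_le_two)

/-- The open cube `(r,1-r)^d`. -/
def innerCube (d : ℕ) (r : ℝ) : Set (EuclideanSpace ℝ (Fin d)) :=
  {x | ∀ i, x i ∈ Set.Ioo r (1 - r)}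

theorem convex_innerCube (d : ℕ) (r : ℝ) : Convex ℝ (innerCube d r) := by
  simp only [innerCube, Set.ofPred_forall]
  exact convex_iInter fun i => (convex_Ioo r (1 - r)).linear_preimage
    (EuclideanSpace.proj (𝕜 := ℝ) i : EuclideanSpace ℝ (Fin d) →L[ℝ] ℝ).toLinearMap

theorem isOpen_innerCube (d : ℕ) (r : ℝ) : IsOpen (innerCube d r) := by
  simp only [innerCube, Set.ofPred_forall]
  exact isOpen_iInter_of_finite fun i => isOpen_Ioo.preimage (by fun_prop)

theorem closedBall_subset_openCube {r : ℝ} {x : EuclideanSpace ℝ (Fin d)}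
    (hx : x ∈ innerCube d r) : Metric.closedBall x r ⊆ openCube d := by
  intro y hy i
  have h1 := (PiLp.norm_apply_le (y - x) i).trans (mem_closedBall_iff_norm.1 hy)
  rw [PiLp.sub_apply, Real.norm_eq_abs, abs_le] at h1
  have h2 := hx i
  simp only [Set.mem_Ioo] at h2 ⊢
  constructor <;> linarith

theorem eventually_mem_innerCube {x : EuclideanSpace ℝ (Fin d)} (hx : x ∈ openCube d)
    {r : ℕ → ℝ} (hr : Tendsto r atTop (𝓝 0)) : ∀ᶠ n in atTop, x ∈ innerCube d (r n) := by
  refine eventually_all.2 fun i => ?_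
  have hi := hx i
  have h2 : Tendsto (fun n => 1 - r n) atTop (𝓝 1) := by simpa using hr.const_sub 1
  filter_upwards [hr.eventually_lt_const hi.1, h2.eventually_const_lt hi.2] with n h3 h4
  exact ⟨h3, h4⟩

/-- Both endpoints must stay in the cube, since f may jump across its boundary. The bound holds for
mollifications on inner cubes, whose convexity keeps the whole segment away from the boundary;
Fatou's lemma then removes the mollification. -/
theorem HasSobolevGradient.lintegral_translate_sub_sq_le
    (hfg : HasSobolevGradient (openCube d) f g) (hf0 : ∀ x, x ∉ openCube d → f x = 0)
    (h : EuclideanSpace ℝ (Fin d)) :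
    ∫⁻ x in openCube d ∩ (fun x => x + h) ⁻¹' openCube d, ‖f (x + h) - f x‖ₑ ^ 2 ≤
      ‖h‖ₑ ^ 2 * ∫⁻ y in openCube d, ‖g y‖ₑ ^ 2 := by
  have hfl : LocallyIntegrable f := (integrable_of_memLp_openCube hf0 hfg.memLp).locallyIntegrable
  have hgm : AEMeasurable (fun y => ‖g y‖ₑ) (volume.restrict (openCube d)) :=
    hfg.memLp_grad.1.enorm
  -- The fixed ratio 2 of the radii is what the a.e. convergence of the mollifications requires.
  let b : ℕ → ContDiffBump (0 : EuclideanSpace ℝ (Fin d)) := fun n =>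
    { rIn := 1 / (n + 1) / 2
      rOut := 1 / (n + 1)
      rIn_pos := by positivity
      rIn_lt_rOut := half_lt_self (by positivity) }
  have hb : Tendsto (fun n => (b n).rOut) atTop (𝓝 0) := tendsto_one_div_add_atTop_nhds_zero_nat
  let F : ℕ → EuclideanSpace ℝ (Fin d) → ℝ := fun n =>
    (b n).normed volume ⋆[lsmul ℝ ℝ, volume] f
  have hFc : ∀ n, Continuous (F n) := fun n =>
    (b n).hasCompactSupport_normed.continuous_convolution_left _ (b n).continuous_normed hfl
  have hlim : ∀ᵐ x, Tendsto (fun n => F n x) atTop (𝓝 (f x)) :=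
    ContDiffBump.ae_convolution_tendsto_right_of_locallyIntegrable (K := 2) hb
      (Eventually.of_forall fun n => (mul_div_cancel₀ _ two_ne_zero).ge) hfl
  have hlim' : ∀ᵐ x, Tendsto (fun n => F n (x + h)) atTop (𝓝 (f (x + h))) :=
    (measurePreserving_add_right volume h).quasiMeasurePreserving.ae hlim
  let V : ℕ → Set (EuclideanSpace ℝ (Fin d)) := fun n =>
    innerCube d (b n).rOut ∩ (fun x => x + h) ⁻¹' innerCube d (b n).rOut
  have hV : ∀ n, MeasurableSet (V n) := fun n =>
    ((isOpen_innerCube d _).inter ((isOpen_innerCube d _).preimage (by fun_prop))).measurableSet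
  let A : ℕ → EuclideanSpace ℝ (Fin d) → ℝ≥0∞ := fun n =>
    (V n).indicator fun x => ‖F n (x + h) - F n x‖ₑ ^ 2
  have hA : ∀ n, Measurable (A n) := fun n =>
    (((((hFc n).comp (by fun_prop)).sub (hFc n)).measurable.enorm).pow_const 2).indicator (hV n)
  have hAle : ∀ n, ∫⁻ x, A n x ≤ ‖h‖ₑ ^ 2 * ∫⁻ y in openCube d, ‖g y‖ₑ ^ 2 := by
    intro n
    have e : ∫⁻ y in openCube d, ‖g y‖ₑ ^ 2 = ∫⁻ y in openCube d, hgm.mk _ y ^ 2 := by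
      refine lintegral_congr_ae ?_
      filter_upwards [hgm.ae_eq_mk] with y hy
      rw [hy]
    rw [e, ← lintegral_lintegral_normed_mul_le (b n) h hgm.measurable_mk]
    refine lintegral_mono fun x => ?_
    refine Set.indicator_le (s := V n) (f := fun x => ‖F n (x + h) - F n x‖ₑ ^ 2)
      (g := fun x => ∫⁻ t in Set.Ioc (0 : ℝ) 1, ∫⁻ y in openCube d,
        ENNReal.ofReal ((b n).normed volume (x + t • h - y)) * (hgm.mk _ y * ‖h‖ₑ) ^ 2)
      (fun x hx => ?_) x
    exact hfg.enorm_sub_convolution_sq_le hf0 hfl (b n) (fun t ht =>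
      closedBall_subset_openCube ((convex_innerCube d _).add_smul_mem hx.1 hx.2 ht))
      hgm.measurable_mk hgm.ae_eq_mk
  have hU : MeasurableSet (openCube d ∩ (fun x => x + h) ⁻¹' openCube d) :=
    ((isOpen_openCube d).inter ((isOpen_openCube d).preimage (by fun_prop))).measurableSet
  calc ∫⁻ x in openCube d ∩ (fun x => x + h) ⁻¹' openCube d, ‖f (x + h) - f x‖ₑ ^ 2
      ≤ ∫⁻ x, liminf (fun n => A n x) atTop := by
        rw [← lintegral_indicator hU]
        refine lintegral_mono_ae ?_
        filter_upwards [hlim, hlim'] with x h1 h2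
        by_cases hx : x ∈ openCube d ∩ (fun x => x + h) ⁻¹' openCube d
        · rw [Set.indicator_of_mem hx]
          refine (Tendsto.liminf_eq ?_).ge
          have h3 : Tendsto (fun n => ‖F n (x + h) - F n x‖ₑ ^ 2) atTop
              (𝓝 (‖f (x + h) - f x‖ₑ ^ 2)) :=
            ((ENNReal.continuous_pow 2).comp continuous_enorm).continuousAt.tendsto.comp
              (h2.sub h1)
          refine h3.congr' ?_
          filter_upwards [eventually_mem_innerCube hx.1 hb, eventually_mem_innerCube hx.2 hb]
            with n h4 h5
          have h6 : x ∈ V n := ⟨h4, h5⟩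
          simp only [A, Set.indicator_of_mem h6]
        · simp [Set.indicator_of_notMem hx]
    _ ≤ liminf (fun n => ∫⁻ x, A n x) atTop := lintegral_liminf_le hA
    _ ≤ _ := (liminf_le_liminf (Eventually.of_forall hAle)).trans (by rw [liminf_const])

/-- In the variables (x, h) with h = y - x, the translation estimate gives at most ρ² ∫ ‖g‖² for
each h, and the ball of radius ρ contributes the remaining ρ^d. -/
theorem HasSobolevGradient.lintegral_sub_sq_le
    (hfg : HasSobolevGradient (openCube d) f g) (hf0 : ∀ x, x ∉ openCube d → f x = 0) {ρ : ℝ}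
    (hρ : 0 ≤ ρ) :
    ∫⁻ p in (openCube d ×ˢ openCube d) ∩ {p | ‖p.1 - p.2‖ ≤ ρ}, ‖f p.1 - f p.2‖ₑ ^ 2 ≤
      ENNReal.ofReal (ρ ^ (d + 2)) * volume (Metric.closedBall (0 : EuclideanSpace ℝ (Fin d)) 1) *
        ∫⁻ y in openCube d, ‖g y‖ₑ ^ 2 := by
  set T : Set (EuclideanSpace ℝ (Fin d) × EuclideanSpace ℝ (Fin d)) :=
    (openCube d ×ˢ openCube d) ∩ {p | ‖p.1 - p.2‖ ≤ ρ}
  set G := ∫⁻ y in openCube d, ‖g y‖ₑ ^ 2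
  have hT : MeasurableSet T :=
    ((isOpen_openCube d).measurableSet.prod (isOpen_openCube d).measurableSet).inter
      (isClosed_le (by fun_prop) continuous_const).measurableSet
  have hfm : AEMeasurable f := (integrable_of_memLp_openCube hf0 hfg.memLp).1.aemeasurable
  have hm : AEMeasurable (T.indicator fun p => ‖f p.1 - f p.2‖ₑ ^ 2) (volume.prod volume) :=
    (((hfm.comp_quasiMeasurePreserving Measure.quasiMeasurePreserving_fst).sub
      (hfm.comp_quasiMeasurePreserving Measure.quasiMeasurePreserving_snd)).enorm.pow_const
      2).indicator hT
  have hmp := measurePreserving_prod_add (volume : Measure (EuclideanSpace ℝ (Fin d)))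
    (volume : Measure (EuclideanSpace ℝ (Fin d)))
  rw [← lintegral_indicator hT, Measure.volume_eq_prod, ← hmp.lintegral_comp_emb
    (MeasurableEquiv.shearAddRight (EuclideanSpace ℝ (Fin d))).measurableEmbedding,
    lintegral_prod_symm (fun z : EuclideanSpace ℝ (Fin d) × EuclideanSpace ℝ (Fin d) =>
      T.indicator (fun p => ‖f p.1 - f p.2‖ₑ ^ 2) (z.1, z.1 + z.2)) (hm.comp_quasiMeasurePreserving hmp.quasiMeasurePreserving)]
  calc ∫⁻ h, ∫⁻ x, T.indicator (fun p => ‖f p.1 - f p.2‖ₑ ^ 2) (x, x + h)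
      ≤ ∫⁻ h : EuclideanSpace ℝ (Fin d), (Metric.closedBall 0 ρ).indicator (fun _ => ENNReal.ofReal (ρ ^ 2) * G) h := by
        refine lintegral_mono fun h => ?_
        by_cases hh : h ∈ Metric.closedBall (0 : EuclideanSpace ℝ (Fin d)) ρ
        · rw [Set.indicator_of_mem hh]
          rw [mem_closedBall_zero_iff] at hh
          have hU : MeasurableSet (openCube d ∩ (fun x => x + h) ⁻¹' openCube d) :=
            ((isOpen_openCube d).inter
              ((isOpen_openCube d).preimage (by fun_prop))).measurableSet
          calc ∫⁻ x, T.indicator (fun p => ‖f p.1 - f p.2‖ₑ ^ 2) (x, x + h)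
              ≤ ∫⁻ x in openCube d ∩ (fun x => x + h) ⁻¹' openCube d,
                  ‖f (x + h) - f x‖ₑ ^ 2 := by
                rw [← lintegral_indicator hU]
                refine lintegral_mono fun x => ?_
                by_cases hx : (x, x + h) ∈ T
                · have : x ∈ openCube d ∩ (fun x => x + h) ⁻¹' openCube d := hx.1
                  simp only
                  rw [Set.indicator_of_mem hx, Set.indicator_of_mem this, ← enorm_neg, neg_sub]
                · simp only
                  rw [Set.indicator_of_notMem hx]
                  exact zero_le
            _ ≤ ‖h‖ₑ ^ 2 * G := hfg.lintegral_translate_sub_sq_le hf0 h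
            _ ≤ ENNReal.ofReal (ρ ^ 2) * G := by
                rw [← ofReal_norm, ← ENNReal.ofReal_pow (norm_nonneg _)]
                gcongr
        · have : ∀ x, (x, x + h) ∉ T := fun x hx => hh (by
            have := hx.2
            simpa using this)
          simp [this]
    _ = _ := by
        rw [lintegral_indicator_const Metric.isClosed_closedBall.measurableSet,
          Measure.addHaar_closedBall' _ _ hρ, finrank_euclideanSpace_fin, pow_add,
          ENNReal.ofReal_mul (by positivity)]
        ring

end Cube

/-! ### Bounding the Dirichlet form, with constants uniform in s. -/

section VarianceBound

variable {d : ℕ} {f : EuclideanSpace ℝ (Fin d) → ℝ} {s A : ℝ}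

/-- The pairs of points of the open unit cube at distance at most `ρ`. -/
def nearDiagonal (d : ℕ) (ρ : ℝ) :
    Set (EuclideanSpace ℝ (Fin d) × EuclideanSpace ℝ (Fin d)) :=
  (openCube d ×ˢ openCube d) ∩ {p | ‖p.1 - p.2‖ ≤ ρ}

theorem measurableSet_nearDiagonal (d : ℕ) (ρ : ℝ) : MeasurableSet (nearDiagonal d ρ) :=
  ((isOpen_openCube d).measurableSet.prod (isOpen_openCube d).measurableSet).inter
    (isClosed_le (by fun_prop) continuous_const).measurableSet

theorem integral_sub_sq_mul_sq_le
    {K : EuclideanSpace ℝ (Fin d) → EuclideanSpace ℝ (Fin d) → ℝ} {ρ L Q : ℝ} (hQ : 0 ≤ Q)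
    (hK : ∀ x y, K x y ≠ 0 → (x ∈ closedCube d ∧ y ∈ closedCube d) ∧ ‖x - y‖ ≤ ρ)
    (hL : ∀ x y, |K x y| ≤ L)
    (hf : ∫⁻ p in nearDiagonal d ρ, ‖f p.1 - f p.2‖ₑ ^ 2 ≤ ENNReal.ofReal Q) :
    ∫ p, (f p.1 - f p.2) ^ 2 * K p.1 p.2 ^ 2 ∂(volume.prod volume) ≤ L ^ 2 * Q := by
  have hL0 : 0 ≤ L := (abs_nonneg _).trans (hL 0 0)
  have hcube := openCube_ae_eq_closedCube d
  have key : ∫⁻ p, ENNReal.ofReal ‖(f p.1 - f p.2) ^ 2 * K p.1 p.2 ^ 2‖ ∂(volume.prod volume) ≤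
      ENNReal.ofReal (L ^ 2 * Q) := by
    calc ∫⁻ p, ENNReal.ofReal ‖(f p.1 - f p.2) ^ 2 * K p.1 p.2 ^ 2‖ ∂(volume.prod volume)
        ≤ ∫⁻ p, ENNReal.ofReal (L ^ 2) *
            (nearDiagonal d ρ).indicator (fun p => ‖f p.1 - f p.2‖ₑ ^ 2) p
            ∂(volume.prod volume) := by
          refine lintegral_mono_ae ?_
          filter_upwards [Measure.quasiMeasurePreserving_fst.ae hcube.mem_iff,
            Measure.quasiMeasurePreserving_snd.ae hcube.mem_iff] with p h1 h2
          by_cases h0 : K p.1 p.2 = 0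
          · simp [h0]
          · obtain ⟨⟨h3, h4⟩, h5⟩ := hK _ _ h0
            have hp : p ∈ nearDiagonal d ρ := ⟨⟨h1.2 h3, h2.2 h4⟩, h5⟩
            rw [Set.indicator_of_mem hp, ← ofReal_norm, ← ENNReal.ofReal_pow (norm_nonneg _),
              ← ENNReal.ofReal_mul (sq_nonneg _)]
            refine ENNReal.ofReal_le_ofReal ?_
            rw [Real.norm_of_nonneg (mul_nonneg (sq_nonneg _) (sq_nonneg _)), Real.norm_eq_abs,
              sq_abs, mul_comm, ← sq_abs (K _ _)]
            exact mul_le_mul_of_nonneg_right (pow_le_pow_left₀ (abs_nonneg _) (hL _ _) 2)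
              (sq_nonneg _)
      _ = ENNReal.ofReal (L ^ 2) * ∫⁻ p in nearDiagonal d ρ, ‖f p.1 - f p.2‖ₑ ^ 2 := by
          rw [lintegral_const_mul' _ _ ENNReal.ofReal_ne_top,
            lintegral_indicator (measurableSet_nearDiagonal d ρ), Measure.volume_eq_prod]
      _ ≤ _ := by
          rw [ENNReal.ofReal_mul (sq_nonneg _)]
          gcongr
  refine (Real.le_norm_self _).trans ((norm_integral_le_lintegral_norm _).trans ?_)
  exact ENNReal.toReal_le_of_le_ofReal (by positivity) key

/-- Near the diagonal the Gagliardo weight is at least ρ^(-(d+2s)). -/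
theorem MemFracSobolev.lintegral_sub_sq_le (hs : 0 < s) (hf : MemFracSobolev s (openCube d) f)
    {ρ : ℝ} (hρ : 0 ≤ ρ) :
    ∫⁻ p in nearDiagonal d ρ, ‖f p.1 - f p.2‖ₑ ^ 2 ≤
      ENNReal.ofReal (ρ ^ ((d : ℝ) + 2 * s) * (gagliardoSq s (openCube d) f).toReal) := by
  have he : 0 < (d : ℝ) + 2 * s := by positivity
  rw [ENNReal.ofReal_mul (by positivity), ENNReal.ofReal_toReal hf.2.ne, gagliardoSq,
    ← lintegral_const_mul' _ _ ENNReal.ofReal_ne_top]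
  refine (setLIntegral_mono' (measurableSet_nearDiagonal d ρ) fun p hp => ?_).trans
    (lintegral_mono_set Set.inter_subset_left)
  rw [← ENNReal.ofReal_mul (by positivity), ← ofReal_norm,
    ← ENNReal.ofReal_pow (norm_nonneg _), Real.norm_eq_abs, sq_abs]
  refine ENNReal.ofReal_le_ofReal ?_
  rcases eq_or_ne p.1 p.2 with h | h
  · simp [h]
  · have h0 : 0 < ‖p.1 - p.2‖ := norm_sub_pos_iff.2 h
    have h1 : 0 < ‖p.1 - p.2‖ ^ ((d : ℝ) + 2 * s) := Real.rpow_pos_of_pos h0 _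
    rw [← mul_div_assoc, le_div_iff₀ h1, mul_comm]
    exact mul_le_mul_of_nonneg_right (Real.rpow_le_rpow h0.le hp.2 he.le) (sq_nonneg _)

theorem HasSobolevGradient.lintegral_sub_sq_le_integral
    {g : EuclideanSpace ℝ (Fin d) → EuclideanSpace ℝ (Fin d)}
    (hfg : HasSobolevGradient (openCube d) f g) (hf0 : ∀ x, x ∉ openCube d → f x = 0) {ρ : ℝ}
    (hρ : 0 ≤ ρ) :
    ∫⁻ p in nearDiagonal d ρ, ‖f p.1 - f p.2‖ₑ ^ 2 ≤
      ENNReal.ofReal (ρ ^ (d + 2) *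
        volume.real (Metric.closedBall (0 : EuclideanSpace ℝ (Fin d)) 1) *
          ∫ y in openCube d, ‖g y‖ ^ 2) := by
  refine (hfg.lintegral_sub_sq_le hf0 hρ).trans_eq ?_
  have h1 : ∫⁻ y in openCube d, ‖g y‖ₑ ^ 2 = ENNReal.ofReal (∫ y in openCube d, ‖g y‖ ^ 2) := by
    rw [ofReal_integral_eq_lintegral_ofReal ((memLp_two_iff_integrable_sq_norm
      hfg.memLp_grad.1).1 hfg.memLp_grad)
      (Filter.Eventually.of_forall fun _ => by positivity)]
    refine lintegral_congr fun y => ?_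
    rw [ENNReal.ofReal_pow (norm_nonneg _), ofReal_norm]
  rw [h1, ENNReal.ofReal_mul (by positivity), ENNReal.ofReal_mul (by positivity),
    ofReal_measureReal (measure_closedBall_lt_top).ne]

/-- The exponent 1 - 2s/d is negative when d = 1 and s > 1/2, so both sides of the comparison of n
with N are needed. Bounding |e| by 1 makes the constant independent of s. -/
theorem rpow_le_mul_rpow {N n c b e : ℝ} (hN : 0 < N) (hc : 0 < c) (hc1 : c ≤ 1) (hb : 1 ≤ b)
    (h1 : c * N ≤ n) (h2 : n ≤ b * N) (he : -1 ≤ e) (he1 : e ≤ 1) :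
    N ^ e ≤ (c⁻¹ + b) * n ^ e := by
  have hn : 0 < n := (mul_pos hc hN).trans_le h1
  have hne : 0 < n ^ e := Real.rpow_pos_of_pos hn e
  rcases le_total 0 e with h0 | h0
  · calc N ^ e ≤ (c⁻¹ * n) ^ e := by
          refine Real.rpow_le_rpow hN.le ?_ h0
          rwa [inv_mul_eq_div, le_div_iff₀ hc, mul_comm]
      _ = c⁻¹ ^ e * n ^ e := Real.mul_rpow (by positivity) hn.le
      _ ≤ c⁻¹ * n ^ e := by
          refine mul_le_mul_of_nonneg_right ?_ hne.le
          simpa using Real.rpow_le_rpow_of_exponent_le ((one_le_inv₀ hc).2 hc1) he1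
      _ ≤ _ := mul_le_mul_of_nonneg_right (by linarith) hne.le
  · calc N ^ e ≤ (b⁻¹ * n) ^ e := by
          refine Real.rpow_le_rpow_of_nonpos (by positivity) ?_ h0
          rw [inv_mul_eq_div, div_le_iff₀ (by positivity)]
          linarith
      _ = b⁻¹ ^ e * n ^ e := Real.mul_rpow (by positivity) hn.le
      _ = b ^ (-e) * n ^ e := by
          rw [Real.inv_rpow (by positivity), Real.rpow_neg (by positivity)]
      _ ≤ b * n ^ e := by
          refine mul_le_mul_of_nonneg_right ?_ hne.le
          simpa using Real.rpow_le_rpow_of_exponent_le hb (by linarith : -e ≤ 1)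
      _ ≤ _ := mul_le_mul_of_nonneg_right (by linarith [inv_pos.2 hc]) hne.le

/-- As D ≥ 1, its exponent can be raised to one that does not involve s. -/
theorem div_rpow_le {D b p q : ℝ} (hD : 1 ≤ D) (hb : 0 < b) (hpq : p ≤ q) :
    (D / b) ^ p ≤ D ^ q * b ^ (-p) := by
  rw [Real.div_rpow (by linarith) hb.le, Real.rpow_neg hb.le, div_eq_mul_inv]
  exact mul_le_mul_of_nonneg_right (Real.rpow_le_rpow_of_exponent_le hD hpq)
    (by positivity)

theorem IsSeminormOf.aemeasurable (hs : 0 < s) (hf : IsTestFunction f) (hA : IsSeminormOf s f A) :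
    AEMeasurable f := by
  rcases hA with ⟨hA, -⟩ | ⟨-, hA, -⟩ | ⟨-, g, hA, -⟩
  · exact (hA.holderWith.continuous (by simpa using hs)).aemeasurable
  · exact (integrable_of_memLp_openCube hf.1 hA.1).1.aemeasurable
  · exact (integrable_of_memLp_openCube hf.1 hA.memLp).1.aemeasurable

/-- The Dirichlet form of a localized kernel is controlled by the smoothness seminorm. -/
theorem IsSeminormOf.integral_sub_sq_mul_sq_le (hs : 0 < s) (hs1 : s ≤ 1) (hf : IsTestFunction f)
    (hA : IsSeminormOf s f A) {K : EuclideanSpace ℝ (Fin d) → EuclideanSpace ℝ (Fin d) → ℝ}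
    {b D B n : ℝ} (hb : 0 < b) (hD : 1 ≤ D)
    (hK : ∀ x y, K x y ≠ 0 → (x ∈ closedCube d ∧ y ∈ closedCube d) ∧ ‖x - y‖ ≤ D / b)
    (hB : ∀ x y, |K x y| ≤ B * b ^ d)
    (hint : Integrable (fun p : _ × _ => K p.1 p.2 ^ 2) (volume.prod volume))
    (hn : ∫ p : _ × _, K p.1 p.2 ^ 2 ∂(volume.prod volume) = n) (hn2 : n ≤ 2 ^ d * b ^ d) :
    ∫ p, (f p.1 - f p.2) ^ 2 * K p.1 p.2 ^ 2 ∂(volume.prod volume) ≤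
      (D ^ 2 * 2 ^ d + B ^ 2 * D ^ (d + 2) *
        (1 + volume.real (Metric.closedBall (0 : EuclideanSpace ℝ (Fin d)) 1))) *
          A ^ 2 * b ^ ((d : ℝ) - 2 * s) := by
  set v := volume.real (Metric.closedBall (0 : EuclideanSpace ℝ (Fin d)) 1)
  have hv : 0 ≤ v := measureReal_nonneg
  have hDb : 0 ≤ D / b := by positivity
  have hbe : 0 < b ^ ((d : ℝ) - 2 * s) := Real.rpow_pos_of_pos hb _
  -- Common end of both Sobolev cases: the supremum of K² gives b^(2d) and the near-diagonal
  -- integral b^(-(d+2s)). The factor 1 + v covers the constant 1 of the Gagliardo case and the ball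
  -- volume v of the gradient case.
  have hrough : (∫⁻ p in nearDiagonal d (D / b), ‖f p.1 - f p.2‖ₑ ^ 2 ≤
      ENNReal.ofReal ((D / b) ^ ((d : ℝ) + 2 * s) * ((1 + v) * A ^ 2))) →
      ∫ p, (f p.1 - f p.2) ^ 2 * K p.1 p.2 ^ 2 ∂(volume.prod volume) ≤
      (D ^ 2 * 2 ^ d + B ^ 2 * D ^ (d + 2) * (1 + v)) * A ^ 2 * b ^ ((d : ℝ) - 2 * s) := by
    intro h
    have h1 : (D / b) ^ ((d : ℝ) + 2 * s) ≤ D ^ (d + 2) * b ^ (-((d : ℝ) + 2 * s)) := by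
      have := div_rpow_le hD hb (p := (d : ℝ) + 2 * s) (q := ((d + 2 : ℕ) : ℝ))
        (by push_cast; linarith)
      rwa [Real.rpow_natCast] at this
    have h2 : (b ^ d) ^ 2 * b ^ (-((d : ℝ) + 2 * s)) = b ^ ((d : ℝ) - 2 * s) := by
      rw [← pow_mul, ← Real.rpow_natCast, ← Real.rpow_add hb]
      congr 1
      push_cast
      ring
    calc ∫ p, (f p.1 - f p.2) ^ 2 * K p.1 p.2 ^ 2 ∂(volume.prod volume)
        ≤ (B * b ^ d) ^ 2 * ((D / b) ^ ((d : ℝ) + 2 * s) * ((1 + v) * A ^ 2)) :=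
          WaveletDPP.integral_sub_sq_mul_sq_le (by positivity) hK hB h
      _ ≤ (B * b ^ d) ^ 2 * (D ^ (d + 2) * b ^ (-((d : ℝ) + 2 * s)) * ((1 + v) * A ^ 2)) := by
          gcongr
      _ = B ^ 2 * D ^ (d + 2) * (1 + v) * A ^ 2 *
            ((b ^ d) ^ 2 * b ^ (-((d : ℝ) + 2 * s))) := by ring
      _ ≤ _ := by
          rw [h2]
          gcongr
          exact le_add_of_nonneg_left (by positivity)
  rcases hA with ⟨hA, rfl⟩ | ⟨hs2, hA, rfl⟩ | ⟨rfl, g, hA, rfl⟩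
  -- The Hölder bound is pointwise on the support of K, so ∬ K² = n is used in place of the
  -- supremum.
  · set A := (nnHolderNorm s.toNNReal f : ℝ)
    have hpt : ∀ p : EuclideanSpace ℝ (Fin d) × EuclideanSpace ℝ (Fin d),
        (f p.1 - f p.2) ^ 2 * K p.1 p.2 ^ 2 ≤
          A ^ 2 * (D ^ 2 * b ^ (-(2 * s))) * K p.1 p.2 ^ 2 := by
      intro p
      by_cases h0 : K p.1 p.2 = 0
      · simp [h0]
      refine mul_le_mul_of_nonneg_right ?_ (sq_nonneg _)
      have h1 := hA.holderWith.dist_le p.1 p.2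
      rw [Real.coe_toNNReal s hs.le, Real.dist_eq, dist_eq_norm] at h1
      have h2 : |f p.1 - f p.2| ≤ A * (D / b) ^ s := h1.trans
        (mul_le_mul_of_nonneg_left (Real.rpow_le_rpow (norm_nonneg _) (hK _ _ h0).2 hs.le)
          NNReal.zero_le_coe)
      have h3 := div_rpow_le hD hb (p := 2 * s) (q := ((2 : ℕ) : ℝ)) (by push_cast; linarith)
      rw [Real.rpow_natCast] at h3
      calc (f p.1 - f p.2) ^ 2 = |f p.1 - f p.2| ^ 2 := (sq_abs _).symm
        _ ≤ (A * (D / b) ^ s) ^ 2 := pow_le_pow_left₀ (abs_nonneg _) h2 2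
        _ = A ^ 2 * (D / b) ^ (2 * s) := by
            rw [mul_pow, ← Real.rpow_natCast ((D / b) ^ s), ← Real.rpow_mul hDb]
            congr 2
            push_cast
            ring
        _ ≤ _ := mul_le_mul_of_nonneg_left h3 (sq_nonneg _)
    have h2 : b ^ (-(2 * s)) * b ^ d = b ^ ((d : ℝ) - 2 * s) := by
      rw [← Real.rpow_natCast, ← Real.rpow_add hb]
      congr 1
      ring
    calc ∫ p, (f p.1 - f p.2) ^ 2 * K p.1 p.2 ^ 2 ∂(volume.prod volume)
        ≤ ∫ p : _ × _, A ^ 2 * (D ^ 2 * b ^ (-(2 * s))) * K p.1 p.2 ^ 2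
            ∂(volume.prod volume) :=
          integral_mono_of_nonneg (Filter.Eventually.of_forall fun p =>
            mul_nonneg (sq_nonneg _) (sq_nonneg _)) (hint.const_mul _)
            (Filter.Eventually.of_forall hpt)
      _ = A ^ 2 * (D ^ 2 * b ^ (-(2 * s))) * n := by rw [integral_const_mul, hn]
      _ ≤ A ^ 2 * (D ^ 2 * b ^ (-(2 * s))) * (2 ^ d * b ^ d) := by gcongr
      _ = D ^ 2 * 2 ^ d * A ^ 2 * (b ^ (-(2 * s)) * b ^ d) := by ring
      _ ≤ _ := by
          rw [h2]
          gcongr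
          exact le_add_of_nonneg_right (by positivity)
  · refine hrough ((hA.lintegral_sub_sq_le hs hDb).trans (ENNReal.ofReal_le_ofReal ?_))
    rw [Real.sq_sqrt ENNReal.toReal_nonneg]
    gcongr
    exact le_mul_of_one_le_left ENNReal.toReal_nonneg (by linarith)
  · refine hrough ((hA.lintegral_sub_sq_le_integral hf.1 hDb).trans
      (ENNReal.ofReal_le_ofReal ?_))
    have h0 : 0 ≤ ∫ y in openCube d, ‖g y‖ ^ 2 := integral_nonneg fun _ => by positivity
    rw [Real.sq_sqrt h0, mul_assoc, ← Real.rpow_natCast]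
    push_cast
    rw [mul_one]
    gcongr
    linarith

end VarianceBound

end WaveletDPP

end

open WaveletDPP
theorem theorem3 (d : ℕ) (hd : 1 ≤ d) (φ : ℝ → ℝ) (hφ : IsAdmissibleScaling φ) :
    ∃ C : ℝ, 0 < C ∧
      ∀ (s : ℝ), 0 < s → s ≤ 1 →
      ∀ (j : ℕ), 1 ≤ numPoints d φ j →
      ∀ (Ω : Type*) [MeasurableSpace Ω] (P : Measure Ω) [IsProbabilityMeasure P]
        (S : Ω → Set (EuclideanSpace ℝ (Fin d))),
        IsDPP P S (waveletKernel d φ j) volume →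
      ∀ (f : EuclideanSpace ℝ (Fin d) → ℝ), IsTestFunction f →
      ∀ (A : ℝ), IsSeminormOf s f A →
        MemLp (linStat S f) 2 P ∧
        Var[linStat S f; P] ≤ C * A ^ 2 * (numPoints d φ j : ℝ) ^ (1 - 2 * s / (d : ℝ)) := by
  obtain ⟨M, hM⟩ := hφ.bounded
  obtain ⟨R', hR'⟩ := hφ.compactSupport.isCompact.isBounded.subset_closedBall 0
  -- The maximum guarantees R ≥ 0.
  set R := max R' 1
  have hR0 : 0 ≤ R := zero_le_one.trans (le_max_right _ _)
  have hR : ∀ x, φ x ≠ 0 → |x| ≤ R := fun x hx => by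
    have := hR' (subset_tsupport _ hx)
    rw [mem_closedBall_zero_iff, Real.norm_eq_abs] at this
    exact this.trans (le_max_left _ _)
  obtain ⟨t, ht⟩ : ∃ t, φ t ≠ 0 := by
    by_contra! h
    have := hφ.integral_eq_one
    simp [h] at this
  have hd0 : (0 : ℝ) < d := by exact_mod_cast hd
  -- The summand 1 secures D ≥ 1, as `div_rpow_le` requires.
  set D := 2 * R * d + 1
  have hD : 1 ≤ D := le_add_of_nonneg_left (by positivity)
  set B := ((2 * R + 1) * M ^ 2) ^ d
  set c := ((2 * R + 2) ^ d)⁻¹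
  have hc : 0 < c := by positivity
  have hc1 : c ≤ 1 := inv_le_one_of_one_le₀ (one_le_pow₀ (by linarith))
  set C₀ := D ^ 2 * 2 ^ d + B ^ 2 * D ^ (d + 2) *
    (1 + volume.real (Metric.closedBall (0 : EuclideanSpace ℝ (Fin d)) 1))
  have hC₀ : 0 < C₀ := add_pos_of_pos_of_nonneg (by positivity) (by positivity)
  -- The half comes from the variance formula, `C₀` from the Dirichlet form, and the last factor
  -- from exchanging 2^(jd) for n.
  refine ⟨2⁻¹ * C₀ * (c⁻¹ + 2 ^ d), by positivity, ?_⟩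
  intro s hs hs1 j hj Ω _ P _ S hS f hf A hA
  obtain ⟨N, hN⟩ := hf.2
  have hKp := hφ.orthonormalScaling.isProjectionKernel (d := d) ht j
  obtain ⟨hmem, hvar⟩ := hS.variance_linStat hKp (hA.aemeasurable hs hf) (M := |N|)
    (abs_nonneg _) fun x => (hN x).trans (le_abs_self _)
  refine ⟨hmem, ?_⟩
  have hb : (0 : ℝ) < 2 ^ j := by positivity
  have hform := hA.integral_sub_sq_mul_sq_le hs hs1 hf hb hD
    (fun x y h => ⟨mem_closedCube_of_waveletKernel_ne_zero h,
      (norm_sub_le_of_waveletKernel_ne_zero hR h).trans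
        (div_le_div_of_nonneg_right (le_add_of_nonneg_right zero_le_one) hb.le)⟩)
    (abs_waveletKernel_le ht hR0 hR hM j) hKp.integrable_sq
    (hφ.orthonormalScaling.integral_waveletKernel_sq ht j) (numPoints_le ht j)
  have hexp : ((2 : ℝ) ^ j) ^ ((d : ℝ) - 2 * s) = (((2 : ℝ) ^ j) ^ d) ^ (1 - 2 * s / d) := by
    rw [← Real.rpow_natCast ((2 : ℝ) ^ j) d, ← Real.rpow_mul hb.le]
    congr 1
    field_simp
  have hs2 : 2 * s / d ≤ 2 := by
    rw [div_le_iff₀ hd0]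
    have : (1 : ℝ) ≤ d := by exact_mod_cast hd
    linarith
  have hs0 : 0 ≤ 2 * s / d := by positivity
  have hpow := rpow_le_mul_rpow (N := ((2 : ℝ) ^ j) ^ d) (e := 1 - 2 * s / d) (by positivity) hc hc1
    (one_le_pow₀ one_le_two : (1 : ℝ) ≤ 2 ^ d) (le_numPoints ht hR0 hR hj) (numPoints_le ht j)
    (by linarith) (by linarith)
  rw [hexp] at hform
  calc Var[linStat S f; P] ≤ 2⁻¹ * (C₀ * A ^ 2 * (((2 : ℝ) ^ j) ^ d) ^ (1 - 2 * s / d)) := by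
        rw [hvar]
        gcongr
    _ ≤ 2⁻¹ * (C₀ * A ^ 2 *
          ((c⁻¹ + 2 ^ d) * (numPoints d φ j : ℝ) ^ (1 - 2 * s / (d : ℝ)))) := by gcongr
    _ = _ := by ring
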